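/- Let $C$ be an algebraically closed field of characteristic zero and let $G\subset \mathrm{GL}_n(C)$ be a classical group ($\mathrm{SL}_n$, or $\mathrm{Sp}$ or $\mathrm{SO}$ of a nondegenerate alternating or symmetric form) whose Lie algebra $\mathfrak g$ has the subalgebra $\mathfrak h$ of its diagonal matrices as Cartan subalgebra; let $T$ be the corresponding diagonal maximal torus. Let $\Phi$ be the root system, $\Delta=\{\alpha_1,\dots,\alpha_l\}$ a basis of $\Phi$, and $\Phi^+=\{\alpha_1,\dots,\alpha_m\}$ the positive roots, enumerated with the simple roots first and with weakly increasing height; $\Phi^-=-\Phi^+$. Let $\mathcal W$ be the Weyl group and $\{H_j, X_\alpha\}$ a Chevalley basis of $\mathfrak g$ with $\mathfrak h=\langle H_1,\dots,H_l\rangle$. Let $\mathbf a^+=(a_i^+)_{i\le m}$, $\mathbf a^-=(a_i^-)_{i\le m}$, $\mathbf a^0=(a^0_j)_{j\le l}$, $\mathbf b=(b_i)_{i\le m}$ be differential indeterminates over the field of constants $C$, and put $$A=\sum_{i=1}^m a_i^+X_{\alpha_i}+\sum_{i=1}^m a_i^-X_{-\alpha_i}+\sum_{j=1}^l a_j^0H_j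 .$$ For $w\in\mathcal W$ write $w(\Phi^+)\cap\Phi^-=\{-\alpha_{i_1},\dots,-\alpha_{i_k}\}$ with distinct indices $i_1,\dots,i_k$ (in any fixed order), $\mathbf b_w=(b_{i_1},\dots,b_{i_k})$ and $u_w=\exp(b_{i_1}X_{-\alpha_{i_1}})\cdots\exp(b_{i_k}X_{-\alpha_{i_k}})$; let $n(w)\in G(C)$ be a representative of $w$ in the normalizer of $T$. With $g=n(w)u_w$, the gauge transform has a unique expansion $$gAg^{-1}+\partial(g)g^{-1}=\sum_{i=1}^m f^+_{w,i}X_{\alpha_i}+\sum_{i=1}^m f^-_{w,i}X_{-\alpha_i}+\sum_{j=1}^l f^0_{w,j}H_j$$ with coefficients in $C\{\mathbf a^+,\mathbf a^-,\mathbf a^0,\mathbf b_w\}$. Let $S_w$ be the differential system $f^+_{w,l+1}=0,\dots,f^+_{w,m}=0$ (without inequations). Call $w$ *resolving* if there is $\Psi\subseteq\Phi^-$ with $w(\Psi)=\Phi^+\setminus\Delta$ and $\Psi\subseteq w(\Phi^+)\cap\Phi^-$. A *ranking* is a total order on the derivatives of the indeterminates such that $\partial^j u>u$ for $j\ge1$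 and which is preserved by differentiation. A ranking on $C\{\mathbf a^+,\mathbf a^-,\mathbf a^0,\mathbf b\}$ is *adapted to the root system* if every derivative of a $b_i$ is ranked higher than every derivative of an $a^{+}_i$, $a^-_i$ or $a^0_j$, if $\partial^{k}b_i>\partial^{k'}b_j$ whenever $k>k'$, and if $b_i>b_j$ implies $|\mathrm{ht}(-\alpha_i)|\ge|\mathrm{ht}(-\alpha_j)|$. The *leader* of a nonconstant differential polynomial is the highest ranked derivative occurring in it; its *initial* is its leading coefficient as a polynomial in the leader, and its *separant* is its partial derivative with respect to the leader. A system of finitely many equations $p_i=0$ and inequations $q_j\ne0$ is *simple* if all $p_i,q_j$ are nonconstant with pairwise distinct leaders; no initial or separant of any $p_i$ or $q_j$ vanishes at a point over an algebraic closure of $C$ (the derivatives being the coordinates) at which all $p_i$ vanish and no $q_j$ does; and no $p_i$ and no $q_j$ can be pseudo-reduced modulo the (other) $p_{i'}$ and their derivatives, where $f$ can be pseudo-reduced modulo $p$ and its derivatives if the leader of $f$ is a proper derivative of the leader of $p$, or equals it and the degree of $f$ in it is at least that of $p$. **Theorem.** Let $w\in\mathcal W$ be resolving, with $\Psi=w^{-1}(\Phi^+\setminus\Delta)$,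 and let $>$ be a ranking on $C\{\mathbf a^+,\mathbf a^-,\mathbf a^0,\mathbf b\}$ adapted to the root system. Then: 1. The differential system $S_w$ is simple with respect to $>$. 2. For $r\in\{l+1,\dots,m\}$ the leader of $f^+_{w,r}$ is $b_i'$, where $-\alpha_i=w^{-1}(\alpha_r)\in\Psi$. 3. The differential polynomials $f^+_{w,l+1},\dots,f^+_{w,m}$ are linear in their leaders and have (nonzero) constant initials. 4. The differential ideal generated by $f^+_{w,l+1},\dots,f^+_{w,m}$ is prime, both in $C\{\mathbf a^+,\mathbf a^-,\mathbf a^0,\mathbf b_w\}$ and in $C\{\mathbf a^+,\mathbf a^-,\mathbf a^0,\mathbf b\}$. 5. For $r\in\{l+1,\dots,m\}$, if the leader of $f^+_{w,r}$ is $b_i'$, then $f^+_{w,r}=c\,a_i^-+h$ with $c\in C\setminus\{0\}$ and $h$ not involving $a_i^-$ or its derivatives, and neither $a_j^-$ nor its derivatives occur in $f^+_{w,r}$ for any $j\neq i$ with $|\mathrm{ht}(-\alpha_j)|\ge|\mathrm{ht}(-\alpha_i)|$. -/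

import Mathlib

noncomputable section

/-! ### Differential polynomials with constant coefficients, rankings, simple systems -/

namespace DiffAlg

/-- The differential polynomial ring `C{V}` over the field of constants `C` in the differential
indeterminates `V`: the variable `(v, j)` is the derivative `∂ʲ v`. -/
abbrev DPoly (C V : Type*) [Field C] := MvPolynomial (V × ℕ) C

/-- The derivation of `C{V}`: zero on `C`, with `∂ (∂ʲ v) = ∂ʲ⁺¹ v`. -/
def delta (C V : Type*) [Field C] : Derivation C (DPoly C V) (DPoly C V) :=
  MvPolynomial.mkDerivation C fun d => MvPolynomial.X (d.1, d.2 + 1)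

/-- A ranking on `C{V}`: a (strict) total order on the derivatives with
`∂ʲ v > v` for `j ≥ 1`, and compatible with differentiation. -/
structure Ranking (V : Type*) where
  lt : V × ℕ → V × ℕ → Prop
  total : IsStrictTotalOrder (V × ℕ) lt
  lt_deriv : ∀ (v : V) (j : ℕ), 1 ≤ j → lt (v, 0) (v, j)
  lt_shift : ∀ (v v' : V) (j j' k : ℕ), lt (v, j) (v', j') → lt (v, j + k) (v', j' + k)

section

variable {C V : Type*} [Field C]

/-- `d` is the leader of `p`: the highest ranked derivative occurring in `p`.
A constant has no leader. -/
def IsLeader (rk : Ranking V) (p : DPoly C V) (d : V × ℕ) : Prop :=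
  d ∈ p.vars ∧ ∀ e ∈ p.vars, e ≠ d → rk.lt e d

/-- The leading coefficient of `p`, regarded as a polynomial in the derivative `d`.
It is the initial of `p` if `d` is the leader of `p`. -/
def initialAt (p : DPoly C V) (d : V × ℕ) : DPoly C V :=
  ∑ s ∈ p.support.filter (fun s => s d = p.degreeOf d), MvPolynomial.monomial (s.erase d) (p.coeff s)

/-- The partial derivative of `p` with respect to `d`.
It is the separant of `p` if `d` is the leader of `p`. -/
def separantAt (p : DPoly C V) (d : V × ℕ) : DPoly C V := MvPolynomial.pderiv d p

/-- A pseudo-reduction of `f` modulo `p` or one of its derivatives is possible: the leader of `f`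
is a proper derivative of the leader of `p` (in which that derivative of `p` has degree one), or
the leaders coincide and the degree of `f` in it is at least the degree of `p`. -/
def PseudoReducible (rk : Ranking V) (f p : DPoly C V) : Prop :=
  ∃ (d e : V × ℕ) (k : ℕ), IsLeader rk f d ∧ IsLeader rk p e ∧ d = (e.1, e.2 + k) ∧
    (k = 0 → p.degreeOf e ≤ f.degreeOf e)

/-- The differential system `p i = 0 (i : σ)`, `q j ≠ 0 (j : τ)` is simple. The points range over
the affine space with the derivatives as coordinates, over an algebraic closure of `C`. -/
structure IsSimpleSystem {σ τ : Type*} (rk : Ranking V) (p : σ → DPoly C V) (q : τ → DPoly C V) :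
    Prop where
  finite_eqs : Finite σ
  finite_ineqs : Finite τ
  eqs_nonconst : ∀ i, ∀ c : C, p i ≠ MvPolynomial.C c
  ineqs_nonconst : ∀ j, ∀ c : C, q j ≠ MvPolynomial.C c
  leaders_eqs : ∀ i i' d, IsLeader rk (p i) d → IsLeader rk (p i') d → i = i'
  leaders_ineqs : ∀ j j' d, IsLeader rk (q j) d → IsLeader rk (q j') d → j = j'
  leaders_mixed : ∀ i j d, IsLeader rk (p i) d → ¬ IsLeader rk (q j) d
  no_zero : ∀ x : V × ℕ → AlgebraicClosure C,
    (∀ i, MvPolynomial.aeval x (p i) = 0) → (∀ j, MvPolynomial.aeval x (q j) ≠ 0) →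
      (∀ i d, IsLeader rk (p i) d →
        MvPolynomial.aeval x (initialAt (p i) d) ≠ 0 ∧ MvPolynomial.aeval x (separantAt (p i) d) ≠ 0) ∧
      (∀ j d, IsLeader rk (q j) d →
        MvPolynomial.aeval x (initialAt (q j) d) ≠ 0 ∧ MvPolynomial.aeval x (separantAt (q j) d) ≠ 0)
  eqs_reduced : ∀ i i', i ≠ i' → ¬ PseudoReducible rk (p i) (p i')
  ineqs_reduced : ∀ j i, ¬ PseudoReducible rk (q j) (p i)

/-- The differential ideal of `C{V}` generated by a set. -/
def diffIdeal (s : Set (DPoly C V)) : Ideal (DPoly C V) :=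
  Ideal.span {g | ∃ p ∈ s, ∃ k : ℕ, g = (delta C V)^[k] p}

/-- The differential polynomials which only involve (derivatives of) indeterminates from `W`,
that is, the differential subring `C{W}` of `C{V}`. -/
def subring (C : Type*) {V : Type*} [Field C] (W : Set V) : Subalgebra C (DPoly C V) :=
  MvPolynomial.supported C {d | d.1 ∈ W}

/-- The differential ideal of the differential subring `C{W}` generated by a set `s ⊆ C{W}`. -/
def diffIdealIn (W : Set V) (s : Set (DPoly C V)) : Ideal (subring C W) :=
  Ideal.span {g | ∃ p ∈ s, ∃ k : ℕ, (g : DPoly C V) = (delta C V)^[k] p}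

/-- Gauge transformation `g A g⁻¹ + ∂(g) g⁻¹` of a matrix over `C{V}`. -/
def gauge {N : ℕ} (g A : Matrix (Fin N) (Fin N) (DPoly C V)) :
    Matrix (Fin N) (Fin N) (DPoly C V) :=
  g * A * g⁻¹ + g.map (delta C V) * g⁻¹

/-- A constant matrix, regarded as a matrix over `C{V}`. -/
def const (V : Type*) {C : Type*} [Field C] {N : ℕ} (M : Matrix (Fin N) (Fin N) C) :
    Matrix (Fin N) (Fin N) (DPoly C V) :=
  M.map MvPolynomial.C

end

end DiffAlg

/-! ### Classical groups, their root systems and Chevalley bases -/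

/-- The classical groups in `GL_N(C)`: `SL_N`, and `Sp(J)`, `SO(J)` for a nondegenerate
alternating, respectively symmetric, form with Gram matrix `J`. -/
inductive ClassicalGroup (C : Type*) [Field C] (N : ℕ) where
  | SL : ClassicalGroup C N
  | Sp (J : Matrix (Fin N) (Fin N) C) (hJ : IsUnit J.det) (alt : J.transpose = -J) :
      ClassicalGroup C N
  | SO (J : Matrix (Fin N) (Fin N) C) (hJ : IsUnit J.det) (symm : J.transpose = J) :
      ClassicalGroup C N

namespace ClassicalGroup

section

variable {C : Type*} [Field C] {N : ℕ}

/-- The isometries of the form with Gram matrix `J`. -/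
def isometries (J : Matrix (Fin N) (Fin N) C) : Subgroup (GL (Fin N) C) where
  carrier := {g | (g : Matrix (Fin N) (Fin N) C).transpose * J * g = J}
  one_mem' := by simp
  mul_mem' := by
    intro a b ha hb
    simp only [Set.mem_ofPred_eq, Units.val_mul, Matrix.transpose_mul] at ha hb ⊢
    calc _ = (b : Matrix (Fin N) (Fin N) C).transpose *
          ((a : Matrix (Fin N) (Fin N) C).transpose * J * a) * b := by
            simp only [Matrix.mul_assoc]
      _ = J := by rw [ha, hb]
  inv_mem' := by
    intro a ha
    simp only [Set.mem_ofPred_eq] at ha ⊢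
    have h1 : (a : Matrix (Fin N) (Fin N) C) * ((a⁻¹ : GL (Fin N) C) : Matrix (Fin N) (Fin N) C) = 1 := by
      rw [← Units.val_mul]; simp
    have h2 : ((a⁻¹ : GL (Fin N) C) : Matrix (Fin N) (Fin N) C).transpose *
        (a : Matrix (Fin N) (Fin N) C).transpose = 1 := by
      rw [← Matrix.transpose_mul, h1, Matrix.transpose_one]
    calc _ = ((a⁻¹ : GL (Fin N) C) : Matrix (Fin N) (Fin N) C).transpose *
          ((a : Matrix (Fin N) (Fin N) C).transpose * J * a) *
          ((a⁻¹ : GL (Fin N) C) : Matrix (Fin N) (Fin N) C) := by rw [ha]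
      _ = (((a⁻¹ : GL (Fin N) C) : Matrix (Fin N) (Fin N) C).transpose *
          (a : Matrix (Fin N) (Fin N) C).transpose) * J *
          ((a : Matrix (Fin N) (Fin N) C) * ((a⁻¹ : GL (Fin N) C) : Matrix (Fin N) (Fin N) C)) := by
            simp only [Matrix.mul_assoc]
      _ = J := by rw [h1, h2]; simp

/-- The group `G(C)`. -/
def group : ClassicalGroup C N → Subgroup (GL (Fin N) C)
  | SL => (Matrix.GeneralLinearGroup.det (n := Fin N) (R := C)).ker
  | Sp J _ _ => isometries J
  | SO J _ _ => isometries J ⊓ (Matrix.GeneralLinearGroup.det (n := Fin N) (R := C)).ker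

/-- The Lie algebra `𝔤` of `G`, as a space of matrices: the matrices of trace zero,
respectively those with `XᵀJ = -JX`. -/
def lieAlg : ClassicalGroup C N → Submodule C (Matrix (Fin N) (Fin N) C)
  | SL => LinearMap.ker (Matrix.traceLinearMap (Fin N) C C)
  | Sp J _ _ => skewAdjointMatricesSubmodule J
  | SO J _ _ => skewAdjointMatricesSubmodule J

/-- The subalgebra `𝔥` of the diagonal matrices in `𝔤`. -/
def cartan (G : ClassicalGroup C N) : Submodule C (Matrix (Fin N) (Fin N) C) where
  carrier := {X | X ∈ G.lieAlg ∧ X.IsDiag}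
  zero_mem' := ⟨zero_mem _, Matrix.isDiag_zero⟩
  add_mem' := fun ha hb => ⟨add_mem ha.1 hb.1, ha.2.add hb.2⟩
  smul_mem' := fun c _ hx => ⟨Submodule.smul_mem _ c hx.1, hx.2.smul c⟩

/-- The torus `T` of the diagonal matrices in `G(C)`. -/
def torus (G : ClassicalGroup C N) : Subgroup (GL (Fin N) C) :=
  G.group ⊓ (Units.map (Matrix.diagonalRingHom (Fin N) C).toMonoidHom).range

/-- Linear functionals on `𝔥`. -/
abbrev Wt (G : ClassicalGroup C N) := Module.Dual C G.cartan

/-- The weight space `𝔤_β`. -/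
def weightSpace (G : ClassicalGroup C N) (β : G.Wt) :
    Submodule C (Matrix (Fin N) (Fin N) C) where
  carrier := {X | X ∈ G.lieAlg ∧ ∀ H : G.cartan, (H : Matrix (Fin N) (Fin N) C) * X - X * H = β H • X}
  zero_mem' := ⟨zero_mem _, by simp⟩
  add_mem' := fun {a b} ha hb => ⟨add_mem ha.1 hb.1, fun H => by
    rw [mul_add, add_mul, smul_add, ← ha.2 H, ← hb.2 H]; abel⟩
  smul_mem' := fun c x hx => ⟨Submodule.smul_mem _ c hx.1, fun H => by
    rw [Matrix.mul_smul, Matrix.smul_mul, ← smul_sub, hx.2 H, smul_comm]⟩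

/-- `β` belongs to the root system `Φ` of `G`. -/
def IsRoot (G : ClassicalGroup C N) (β : G.Wt) : Prop := β ≠ 0 ∧ G.weightSpace β ≠ ⊥

end

end ClassicalGroup

open ClassicalGroup

/-- A basis `Δ = {α₁, …, α_l}` of `Φ` together with an enumeration `α₁, …, α_m` of the positive
roots which starts with the simple roots and along which the height is weakly increasing. -/
structure RootEnum {C : Type*} [Field C] {N : ℕ} (G : ClassicalGroup C N) (l m : ℕ) where
  le : l ≤ m
  root : Fin m → G.Wt
  root_inj : Function.Injective root
  isRoot_iff : ∀ β : G.Wt, G.IsRoot β ↔ ∃ i, β = root i ∨ β = -root i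
  simple_indep : LinearIndependent C fun j : Fin l => root (Fin.castLE le j)
  /-- the coefficients of the positive roots with respect to the simple roots -/
  coeff : Fin m → Fin l → ℕ
  root_eq : ∀ i, root i = ∑ j, coeff i j • root (Fin.castLE le j)
  height_mono : ∀ r s : Fin m, r ≤ s → ∑ j, coeff r j ≤ ∑ j, coeff s j

namespace RootEnum

section

variable {C : Type*} [Field C] {N : ℕ} {G : ClassicalGroup C N} {l m : ℕ}

/-- The simple root `α_j`. -/
def simple (P : RootEnum G l m) (j : Fin l) : G.Wt := P.root (Fin.castLE P.le j)

/-- The height of `α_i`, which is `|height (-α_i)|`. -/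
def height (P : RootEnum G l m) (i : Fin m) : ℕ := ∑ j, P.coeff i j

/-- The positive roots `Φ⁺`. -/
def positive (P : RootEnum G l m) : Set G.Wt := Set.range P.root

/-- The negative roots `Φ⁻`. -/
def negative (P : RootEnum G l m) : Set G.Wt := Set.range fun i => -P.root i

/-- The basis `Δ`. -/
def simples (P : RootEnum G l m) : Set G.Wt := Set.range P.simple

/-- Resolving elements: there is `Ψ ⊆ Φ⁻` with `w(Ψ) = Φ⁺ \ Δ` and `w(Φ⁺) ∩ Φ⁻ ⊇ Ψ`. -/
def IsResolving (P : RootEnum G l m) (w : G.Wt ≃ₗ[C] G.Wt) : Prop :=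
  ∃ Ψ : Set G.Wt, Ψ ⊆ P.negative ∧ w '' Ψ = P.positive \ P.simples ∧
    Ψ ⊆ (w '' P.positive) ∩ P.negative

end

end RootEnum

/-- A Chevalley basis `{H_j, X_α}` of `𝔤`. Only the values of `X` at roots are relevant. -/
structure ChevalleyBasis {C : Type*} [Field C] {N : ℕ} {G : ClassicalGroup C N} {l m : ℕ}
    (P : RootEnum G l m) where
  H : Fin l → G.cartan
  X : G.Wt → Matrix (Fin N) (Fin N) C
  X_mem : ∀ β, G.IsRoot β → X β ∈ G.weightSpace β
  /-- `[X_β, X_{-β}]` is the coroot `H_β` -/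
  lie_neg : ∀ β, G.IsRoot β →
    ∃ Hβ : G.cartan, (Hβ : Matrix (Fin N) (Fin N) C) = X β * X (-β) - X (-β) * X β ∧ β Hβ = 2
  H_eq : ∀ j, (H j : Matrix (Fin N) (Fin N) C) =
    X (P.simple j) * X (-P.simple j) - X (-P.simple j) * X (P.simple j)
  /-- `[X_β, X_γ] = ±(r + 1) X_{β + γ}`, where `r` is the largest integer such that
  `γ - r β` is a root in the `β`-string through `γ` -/
  lie_add : ∀ β γ, G.IsRoot β → G.IsRoot γ → G.IsRoot (β + γ) →
    ∃ r : ℕ, (∀ k ≤ r, G.IsRoot (γ - k • β)) ∧ ¬ G.IsRoot (γ - (r + 1) • β) ∧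
      (X β * X γ - X γ * X β = (r + 1) • X (β + γ) ∨
        X β * X γ - X γ * X β = -((r + 1) • X (β + γ)))
  indep : LinearIndependent C (Sum.elim (fun j => (H j : Matrix (Fin N) (Fin N) C))
    (Sum.elim (fun i => X (P.root i)) (fun i => X (-P.root i))))
  span_eq : Submodule.span C (Set.range (Sum.elim (fun j => (H j : Matrix (Fin N) (Fin N) C))
    (Sum.elim (fun i => X (P.root i)) (fun i => X (-P.root i))))) = G.lieAlg
  span_H : Submodule.span C (Set.range H) = ⊤

/-- The differential indeterminates `a⁺_i, a⁻_i, a⁰_j, b_i`. -/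
inductive GVar (l m : ℕ) where
  | ap (i : Fin m) : GVar l m
  | am (i : Fin m) : GVar l m
  | a0 (j : Fin l) : GVar l m
  | b (i : Fin m) : GVar l m

/-- Rankings on `C{a⁺, a⁻, a⁰, b}` which are adapted to the root system. -/
structure IsAdapted {C : Type*} [Field C] {N : ℕ} {G : ClassicalGroup C N} {l m : ℕ}
    (P : RootEnum G l m) (rk : DiffAlg.Ranking (GVar l m)) : Prop where
  elim_ap : ∀ i k j k', rk.lt (GVar.ap i, k) (GVar.b j, k')
  elim_am : ∀ i k j k', rk.lt (GVar.am i, k) (GVar.b j, k')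
  elim_a0 : ∀ i k j k', rk.lt (GVar.a0 i, k) (GVar.b j, k')
  orderly : ∀ i j k k', k < k' → rk.lt (GVar.b i, k) (GVar.b j, k')
  height : ∀ i j, rk.lt (GVar.b j, 0) (GVar.b i, 0) → P.height j ≤ P.height i

namespace ChevalleyBasis

open DiffAlg

section

variable {C : Type*} [Field C] {N : ℕ} {G : ClassicalGroup C N} {l m : ℕ} {P : RootEnum G l m}

/-- The Weyl group, acting on `𝔥*`, generated by the simple reflections
`β ↦ β - β(H_j) α_j`. -/
def weylGroup (B : ChevalleyBasis P) : Subgroup (G.Wt ≃ₗ[C] G.Wt) :=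
  Subgroup.closure {s | ∃ j, ∀ β, s β = β - β (B.H j) • P.simple j}

/-- `∑ x_i X_{α_i} + ∑ y_i X_{-α_i} + ∑ z_j H_j` for differential polynomials `x, y, z`. -/
def combo (B : ChevalleyBasis P) (x y : Fin m → DPoly C (GVar l m))
    (z : Fin l → DPoly C (GVar l m)) : Matrix (Fin N) (Fin N) (DPoly C (GVar l m)) :=
  ∑ i, x i • const (GVar l m) (B.X (P.root i)) + ∑ i, y i • const (GVar l m) (B.X (-P.root i)) +
    ∑ j, z j • const (GVar l m) (B.H j : Matrix (Fin N) (Fin N) C)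

/-- The general element `A` of the Lie algebra. -/
def generic (B : ChevalleyBasis P) : Matrix (Fin N) (Fin N) (DPoly C (GVar l m)) :=
  B.combo (fun i => MvPolynomial.X (GVar.ap i, 0)) (fun i => MvPolynomial.X (GVar.am i, 0))
    (fun j => MvPolynomial.X (GVar.a0 j, 0))

/-- The root group element `u_{-α_i}(b_i) = exp (b_i X_{-α_i})`. -/
def rootElt [CharZero C] (B : ChevalleyBasis P) (i : Fin m) :
    Matrix (Fin N) (Fin N) (DPoly C (GVar l m)) :=
  IsNilpotent.exp
    ((MvPolynomial.X (GVar.b i, 0) : DPoly C (GVar l m)) • const (GVar l m) (B.X (-P.root i)))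

/-- The product `u_{-α_{i₁}}(b_{i₁}) ⋯ u_{-α_{i_k}}(b_{i_k})` over a list of indices. -/
def unipotent [CharZero C] (B : ChevalleyBasis P) (L : List (Fin m)) :
    Matrix (Fin N) (Fin N) (DPoly C (GVar l m)) :=
  (L.map B.rootElt).prod

end

end ChevalleyBasis

/-- `n ∈ G(C)` is a representative of `w` in the normalizer of `T`:
`(w α)(n H n⁻¹) = α(H)` for all `α ∈ 𝔥*` and `H ∈ 𝔥`. -/
def Represents {C : Type*} [Field C] {N : ℕ} (G : ClassicalGroup C N)
    (n : GL (Fin N) C) (w : G.Wt ≃ₗ[C] G.Wt) : Prop :=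
  n ∈ G.group ∧ n ∈ Subgroup.normalizer (G.torus : Set (GL (Fin N) C)) ∧
    ∀ H : G.cartan, ∃ H' : G.cartan,
      (H' : Matrix (Fin N) (Fin N) C) = (n : Matrix (Fin N) (Fin N) C) * H *
        ((n⁻¹ : GL (Fin N) C) : Matrix (Fin N) (Fin N) C) ∧
      ∀ α : G.Wt, (w α) H' = α H

/-- The coefficients `f⁺_i, f⁻_i, f⁰_j` of a matrix with respect to the Chevalley basis. -/
structure Coeffs (C : Type*) [Field C] (l m : ℕ) where
  fp : Fin m → DiffAlg.DPoly C (GVar l m)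
  fm : Fin m → DiffAlg.DPoly C (GVar l m)
  f0 : Fin l → DiffAlg.DPoly C (GVar l m)

/-- `F` consists of the coefficients of the gauge transform of `A` by `n(w) u_w(b_w)`. -/
def IsGaugeCoeffs {C : Type*} [Field C] [CharZero C] {N : ℕ} {G : ClassicalGroup C N} {l m : ℕ}
    {P : RootEnum G l m} (B : ChevalleyBasis P) (n : GL (Fin N) C) (L : List (Fin m))
    (F : Coeffs C l m) : Prop :=
  DiffAlg.gauge (DiffAlg.const (GVar l m) (n : Matrix (Fin N) (Fin N) C) * B.unipotent L)
    B.generic = B.combo F.fp F.fm F.f0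

/-- The indeterminates `a⁺, a⁻, a⁰, b_w`, where `b_w` consists of the `b_i` with `i ∈ L`. -/
def varsOf {l m : ℕ} (L : List (Fin m)) : Set (GVar l m) :=
  {v | ∀ i, v = GVar.b i → i ∈ L}

/-- The equations `f⁺_{l+1}, …, f⁺_m` of the system `S_w`. -/
def systemEqs {C : Type*} [Field C] {l m : ℕ} (F : Coeffs C l m) :
    {r : Fin m // l ≤ (r : ℕ)} → DiffAlg.DPoly C (GVar l m) :=
  fun r => F.fp r

end

/-! The factor u_w is a product of exponentials of negative root vectors, so it is unipotent for the
filtration of 𝔤 by height. Conjugation by it changes each Chevalley basis element only by terms of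
strictly smaller height with coefficients in C[b_w], and its logarithmic derivative is the sum of
the b_i' (X_{-α_i} + terms of smaller height), again over C[b_w]. Hence for i in `L` the coefficient
of X_{-α_i} in the gauge transform by u_w is b_i' + a⁻_i + q, where q involves only the a⁺, a⁰, b_w
themselves and those a⁻_j, b_j' with ht α_j < ht α_i (`exists_coords_gauge_unipotent`).

Conjugation by n(w) moves weight spaces as w prescribes. Since root spaces are lines, f⁺_r is a
nonzero constant times the coefficient at -α_i = w⁻¹(α_r) (`exists_coords_gauge`). That w is
resolving says that for every non-simple α_r this i exists and lies in `L`.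

All claims follow from this shape, recorded as `HasShape`. In an adapted ranking b_i' outranks
everything else, it has a constant coefficient, and distinct r give distinct indeterminates b_i, so
the system is simple. For primality, the k-th derivative of an equation can be solved for the
(k+1)-st derivative of b_i in terms of variables of smaller ℕ-valued weight. Recursive substitution
is then a homomorphism into a polynomial ring whose kernel is exactly the differential ideal
(`isPrime_of_triangular`), and a polynomial ring is a domain. -/

noncomputable section

/-! ### Primality of triangular ideals -/

namespace DiffAlg

open MvPolynomial

section Triangular

variable {C σ ι : Type*} [Field C]

open Classical in
/-- Substitution which eliminates the variables `lead i` by means of `lead i = h i`. -/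
def elimVar (μ : σ → ℕ) (lead : ι → σ) (h : ι → MvPolynomial σ C) (s : σ) : MvPolynomial σ C :=
  if hs : ∃ i, lead i = s then
    -- The weight test only makes the recursion terminate. When the variables of each `h i` have
    -- smaller weight than `lead i`, the default `0` is never used.
    aeval (fun t => if _ht : μ t < μ s then elimVar μ lead h t else 0) (h hs.choose)
  else X s
termination_by μ s

variable {μ : σ → ℕ} {lead : ι → σ} {h : ι → MvPolynomial σ C}

theorem elimVar_of_notMem {s : σ} (hs : ∀ i, lead i ≠ s) : elimVar μ lead h s = X s := by
  rw [elimVar, dif_neg (by simpa using hs)]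

theorem elimVar_lead (hlead : Function.Injective lead)
    (hvars : ∀ i, ∀ t ∈ (h i).vars, μ t < μ (lead i)) (i : ι) :
    elimVar μ lead h (lead i) = aeval (elimVar μ lead h) (h i) := by
  rw [elimVar]
  have hs : ∃ j, lead j = lead i := ⟨i, rfl⟩
  have hc : hs.choose = i := hlead hs.choose_spec
  rw [dif_pos hs, hc]
  refine eval₂Hom_congr' rfl (fun t ht _ => ?_) rfl
  exact dif_pos (hvars i t ht)

/-- The polynomials satisfying the conclusion form a subalgebra, so checking variables suffices.
Preimages under `emb` appear because `A` is known only through its embedding, and `φ` acts on the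
larger ring. -/
theorem exists_congr_of_forall_X {A : Type*} [CommRing A] [Algebra C A]
    (emb : A →ₐ[C] MvPolynomial σ C) (φ : MvPolynomial σ C →ₐ[C] MvPolynomial σ C) (I : Ideal A)
    {T : Set σ} (hT : ∀ t ∈ T, ∃ x y : A, emb x = X t ∧ emb y = φ (X t) ∧ x - y ∈ I)
    {p : MvPolynomial σ C} (hp : p ∈ supported C T) :
    ∃ x y : A, emb x = p ∧ emb y = φ p ∧ x - y ∈ I := by
  refine Algebra.adjoin_induction (fun p hp => ?_) (fun r => ?_) (fun p q _ _ hp hq => ?_)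
    (fun p q _ _ hp hq => ?_) hp
  · obtain ⟨s, hs, rfl⟩ := hp
    exact hT s hs
  · exact ⟨algebraMap C A r, algebraMap C A r, by simp, by simp, by simp⟩
  · obtain ⟨x, y, h1, h2, h3⟩ := hp
    obtain ⟨x', y', h1', h2', h3'⟩ := hq
    refine ⟨x + x', y + y', by simp [*], by simp [*], ?_⟩
    rw [add_sub_add_comm]; exact add_mem h3 h3'
  · obtain ⟨x, y, h1, h2, h3⟩ := hp
    obtain ⟨x', y', h1', h2', h3'⟩ := hq
    refine ⟨x * x', y * y', by simp [*], by simp [*], ?_⟩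
    have : x * x' - y * y' = x' * (x - y) + y * (x' - y') := by ring
    rw [this]; exact add_mem (Ideal.mul_mem_left _ _ h3) (Ideal.mul_mem_left _ _ h3')

/-- An ideal generated by polynomials `X (lead i) - h i`, in which the variables of `h i` are smaller
than `lead i`, is prime. The polynomial ring `A` is given by its embedding into a larger one. -/
theorem isPrime_of_triangular {A : Type*} [CommRing A] [Algebra C A]
    (emb : A →ₐ[C] MvPolynomial σ C) (hemb : Function.Injective emb) (W : Set σ)
    (hW : emb.range = supported C W) (hlead : Function.Injective lead)
    (hvars : ∀ i, ∀ t ∈ (h i).vars, μ t < μ (lead i)) (hvarsW : ∀ i, ∀ t ∈ (h i).vars, t ∈ W)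
    {c : ι → C} (hc : ∀ i, c i ≠ 0) (gens : Set A)
    (hgens : ∀ g : A, g ∈ gens ↔ ∃ i, emb g = MvPolynomial.C (c i) * (X (lead i) - h i)) :
    (Ideal.span gens).IsPrime := by
  set φ := aeval (R := C) (elimVar μ lead h) with hφ
  have hker : ∀ i, φ (X (lead i) - h i) = 0 := fun i => by
    rw [map_sub, hφ, aeval_X, elimVar_lead hlead hvars, sub_self]
  have hXW : ∀ t ∈ W, ∃ x : A, emb x = X t := fun t ht =>
    (AlgHom.mem_range emb).1 (hW ▸ (X_mem_supported.2 ht))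
  -- every variable is congruent to its image
  have key : ∀ k, ∀ t ∈ W, μ t < k → ∃ x y : A, emb x = X t ∧ emb y = φ (X t) ∧
      x - y ∈ Ideal.span gens := by
    intro k
    induction k with
    | zero => intro t _ ht; omega
    | succ k ih =>
      intro t ht htk
      obtain ⟨x, hx⟩ := hXW t ht
      by_cases hs : ∃ i, lead i = t
      · obtain ⟨i, rfl⟩ := hs
        obtain ⟨x', y', h1, h2, h3⟩ := exists_congr_of_forall_X emb φ (Ideal.span gens)
          (T := W ∩ {t | μ t < k}) (p := h i) (fun s hs => ih s hs.1 hs.2) (mem_supported.2 fun s hs =>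
          ⟨hvarsW i s hs, by have := hvars i s hs; simp only [Set.mem_ofPred_eq]; omega⟩)
        refine ⟨x, y', hx, ?_, ?_⟩
        · rw [h2, ← sub_eq_zero, ← map_sub, ← neg_sub, map_neg, hker, neg_zero]
        · have : x - y' = (x - x') + (x' - y') := by ring
          rw [this]
          have hmem : algebraMap C A (c i) * (x - x') ∈ gens := (hgens _).2 ⟨i, by
            rw [map_mul, map_sub, hx, h1, AlgHom.commutes]; rfl⟩
          have hx' : x - x' = algebraMap C A (c i)⁻¹ * (algebraMap C A (c i) * (x - x')) := by
            rw [← mul_assoc, ← map_mul, inv_mul_cancel₀ (hc i), map_one, one_mul]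
          rw [hx']
          exact add_mem (Ideal.mul_mem_left _ _ (Ideal.subset_span hmem)) h3
      · refine ⟨x, x, hx, ?_, by simp⟩
        rw [hx, hφ, aeval_X, elimVar_of_notMem]
        simpa using hs
  have hall : ∀ p ∈ supported C W, _ := fun p => exists_congr_of_forall_X emb φ (Ideal.span gens)
    (T := W) (p := p) fun s hs => key (μ s + 1) s hs (by omega)
  -- Each `g` is congruent to an element with image `φ (emb g)`. If the latter is zero, injectivity
  -- of `emb` puts `g` in the ideal.
  have heq : Ideal.span gens = RingHom.ker (φ.comp emb) := by
    apply le_antisymm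
    · rw [Ideal.span_le]
      intro g hg
      obtain ⟨i, hi⟩ := (hgens g).1 hg
      rw [SetLike.mem_coe, RingHom.mem_ker, AlgHom.comp_apply, hi, map_mul, hker, mul_zero]
    · intro g hg
      obtain ⟨x, y, h1, h2, h3⟩ := hall (emb g) (hW ▸ (AlgHom.mem_range emb).2 ⟨g, rfl⟩)
      have hy : y = 0 := hemb (by
        rw [h2, map_zero]; exact hg)
      rw [hy, sub_zero, hemb h1] at h3
      exact h3
  rw [heq]
  exact RingHom.ker_isPrime _

end Triangular

/-! ### Polynomials linear in a distinguished variable -/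

section Linear

variable {C σ : Type*} [Field C]

theorem degreeOf_eq_zero_of_notMem_vars {p : MvPolynomial σ C} {d : σ} (h : d ∉ p.vars) :
    p.degreeOf d = 0 := by
  by_contra h0
  exact h (mem_vars_iff_degreeOf_ne_zero.2 h0)

theorem coeff_single_of_notMem_vars {p : MvPolynomial σ C} {d : σ} (h : d ∉ p.vars) {s : σ →₀ ℕ}
    (hs : s d ≠ 0) : p.coeff s = 0 := by
  by_contra h0
  exact hs (mem_support_notMem_vars_zero (mem_support_iff.2 h0) h)

open Classical in
theorem coeff_linear {c : C} {d : σ} {p : MvPolynomial σ C} (h : d ∉ p.vars) {s : σ →₀ ℕ}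
    (hs : s d ≠ 0) : (MvPolynomial.C c * X d + p).coeff s = if Finsupp.single d 1 = s then c else 0 := by
  rw [coeff_add, coeff_single_of_notMem_vars h hs, add_zero, coeff_C_mul, coeff_X]
  split_ifs <;> simp

theorem degreeOf_linear {c : C} (hc : c ≠ 0) {d : σ} {p : MvPolynomial σ C} (h : d ∉ p.vars) :
    (MvPolynomial.C c * X d + p).degreeOf d = 1 := by
  classical
  apply le_antisymm
  · refine (degreeOf_add_le _ _ _).trans ?_
    rw [degreeOf_eq_zero_of_notMem_vars h]
    refine max_le ((degreeOf_C_mul_le _ _ _).trans ?_) (Nat.zero_le _)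
    rw [degreeOf_X]; simp
  · have : Finsupp.single d 1 ∈ (MvPolynomial.C c * X d + p).support := by
      rw [mem_support_iff, coeff_linear h (by simp)]; simpa using hc
    simpa using monomial_le_degreeOf d this

end Linear

section LinearD

variable {C V : Type*} [Field C]

theorem initialAt_linear {c : C} (hc : c ≠ 0) {d : V × ℕ} {p : DPoly C V} (h : d ∉ p.vars) :
    initialAt (MvPolynomial.C c * X d + p) d = MvPolynomial.C c := by
  classical
  unfold initialAt
  rw [degreeOf_linear hc h]
  have : (MvPolynomial.C c * X d + p).support.filter (fun s : V × ℕ →₀ ℕ => s d = 1) = {Finsupp.single d 1} := by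
    ext s
    simp only [Finset.mem_filter, mem_support_iff, Finset.mem_singleton]
    constructor
    · rintro ⟨h1, h2⟩
      rw [coeff_linear h (by omega)] at h1
      by_contra h3
      exact h1 (if_neg (Ne.symm h3))
    · rintro rfl
      rw [coeff_linear h (by simp)]; simpa using hc
  rw [this, Finset.sum_singleton, coeff_linear h (by simp), if_pos rfl, Finsupp.erase_single]
  rfl

theorem separantAt_linear {c : C} {d : V × ℕ} {p : DPoly C V} (h : d ∉ p.vars) :
    separantAt (MvPolynomial.C c * X d + p) d = MvPolynomial.C c := by
  unfold separantAt
  rw [map_add, pderiv_eq_zero_of_notMem_vars h, pderiv_C_mul, pderiv_X_self, add_zero, mul_one]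

theorem mem_vars_linear {c : C} (hc : c ≠ 0) {d : V × ℕ} {p : DPoly C V} (h : d ∉ p.vars) :
    d ∈ (MvPolynomial.C c * X d + p).vars := by
  rw [mem_vars_iff_degreeOf_ne_zero, degreeOf_linear hc h]; exact one_ne_zero

theorem IsLeader.unique {rk : Ranking V} {p : DPoly C V} {d e : V × ℕ} (hd : IsLeader rk p d)
    (he : IsLeader rk p e) : d = e := by
  by_contra hne
  have := rk.total
  exact asymm_of rk.lt (hd.2 e he.1 (Ne.symm hne)) (he.2 d hd.1 hne)

/-- If `T` contains `S` and the derivatives of its members, then `∂` maps `C[S]` to `C[T]`. -/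
theorem delta_mem_supported {S T : Set (V × ℕ)} (hST : S ⊆ T)
    (hT : ∀ d ∈ S, (d.1, d.2 + 1) ∈ T) {p : DPoly C V} (hp : p ∈ supported C S) :
    delta C V p ∈ supported C T := by
  have hle := supported_mono (R := C) hST
  refine (Algebra.adjoin_induction (p := fun p _ => p ∈ supported C T ∧ delta C V p ∈ supported C T)
    (fun p hp => ?_) (fun r => ?_) (fun p q _ _ hp hq => ?_) (fun p q _ _ hp hq => ?_) hp).2
  · obtain ⟨d, hd, rfl⟩ := hp
    refine ⟨X_mem_supported.2 (hST hd), ?_⟩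
    rw [delta, mkDerivation_X]
    exact X_mem_supported.2 (hT d hd)
  · exact ⟨Subalgebra.algebraMap_mem _ _, by rw [Derivation.map_algebraMap]; exact zero_mem _⟩
  · exact ⟨add_mem hp.1 hq.1, by rw [map_add]; exact add_mem hp.2 hq.2⟩
  · refine ⟨mul_mem hp.1 hq.1, ?_⟩
    rw [Derivation.leibniz, smul_eq_mul, smul_eq_mul]
    exact add_mem (mul_mem hp.1 hq.2) (mul_mem hq.1 hp.2)

theorem iterate_delta_X (v : V) (j k : ℕ) :
    (delta C V)^[k] (X (v, j)) = X (v, j + k) := by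
  induction k with
  | zero => rfl
  | succ k ih => rw [Function.iterate_succ_apply', ih, delta, mkDerivation_X]; rfl

theorem iterate_delta_C_mul_add (c : C) (p q : DPoly C V) (k : ℕ) :
    (delta C V)^[k] (MvPolynomial.C c * (p + q)) = MvPolynomial.C c * ((delta C V)^[k] p + (delta C V)^[k] q) := by
  induction k with
  | zero => rfl
  | succ k ih =>
    rw [Function.iterate_succ_apply', ih, ← smul_eq_C_mul, Derivation.map_smul, map_add,
      smul_eq_C_mul, ← Function.iterate_succ_apply' (f := delta C V), ← Function.iterate_succ_apply' (f := delta C V)]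

end LinearD

end DiffAlg
end

/-! ### From the shape of the equations to simplicity and primality -/

noncomputable section

open DiffAlg MvPolynomial ClassicalGroup

/-- The derivatives which may occur in the lower order part of an equation with leader `b_i'`. -/
def lowerVars {C : Type*} [Field C] {N : ℕ} {G : ClassicalGroup C N} {l m : ℕ}
    (P : RootEnum G l m) (L : List (Fin m)) (i : Fin m) : Set (GVar l m × ℕ) :=
  {d | d.1 ∈ varsOf L ∧ d.2 ≤ 1 ∧ (d.2 = 1 → ∃ k, d.1 = GVar.b k ∧ P.height k < P.height i) ∧
    ∀ j, d.1 = GVar.am j → P.height j < P.height i}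

section

variable {C : Type*} [Field C] {N : ℕ} {G : ClassicalGroup C N} {l m : ℕ}
    {P : RootEnum G l m} {rk : Ranking (GVar l m)} {L : List (Fin m)}

/-- Parameters are eliminated last and the ranking is orderly on the b's, so only b_k' with ht α_k <
ht α_i needs care. Adaptedness forbids b_k > b_i there, totality then gives b_k < b_i, and
differentiation preserves this. -/
theorem lt_of_mem_lowerVars (hrk : IsAdapted P rk) {i : Fin m} {d : GVar l m × ℕ}
    (hd : d ∈ lowerVars P L i) : rk.lt d (GVar.b i, 1) := by
  obtain ⟨v, j⟩ := d
  obtain ⟨-, hj, h1, -⟩ := hd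
  cases v with
  | ap k => exact hrk.elim_ap _ _ _ _
  | am k => exact hrk.elim_am _ _ _ _
  | a0 k => exact hrk.elim_a0 _ _ _ _
  | b k =>
    rcases Nat.lt_or_ge j 1 with h0 | h0
    · exact hrk.orderly _ _ _ _ h0
    · obtain rfl : j = 1 := le_antisymm hj h0
      obtain ⟨k', hk', hlt⟩ := h1 rfl
      obtain rfl : k = k' := by simpa using hk'
      have := rk.total
      rcases trichotomous_of rk.lt (GVar.b k, 0) (GVar.b i, 0) with h | h | h
      · exact rk.lt_shift _ _ 0 0 1 h
      · simp only [Prod.mk.injEq, GVar.b.injEq, and_true] at h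
        subst h; exact absurd hlt (lt_irrefl _)
      · exact absurd (hrk.height _ _ h) (not_le.2 hlt)

theorem lead_notMem_lowerVars (i : Fin m) (k : ℕ) :
    ((GVar.b i, 1) : GVar l m × ℕ) ∉ lowerVars P L i ∧
      ((GVar.am i, k) : GVar l m × ℕ) ∉ lowerVars P L i := by
  refine ⟨?_, ?_⟩
  · rintro ⟨-, -, h, -⟩
    obtain ⟨k, hk, hlt⟩ := h rfl
    obtain rfl : i = k := by simpa using hk
    exact lt_irrefl _ hlt
  · rintro ⟨-, -, -, h⟩
    exact lt_irrefl _ (h i rfl)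

/-- The shape of the equations: up to a constant factor, `b_i' + a⁻_i` plus terms of lower order. -/
def HasShape (P : RootEnum G l m) (L : List (Fin m)) (i : Fin m) (f : DPoly C (GVar l m)) : Prop :=
  i ∈ L ∧ ∃ c : C, c ≠ 0 ∧ ∃ q ∈ supported C (lowerVars P L i),
    f = MvPolynomial.C c * (X (GVar.b i, 1) + (X (GVar.am i, 0) + q))

theorem HasShape.exists_linear {i : Fin m} {f : DPoly C (GVar l m)} (hf : HasShape P L i f) :
    ∃ c : C, c ≠ 0 ∧ ∃ p : DPoly C (GVar l m),
      (∀ d ∈ p.vars, d ∈ lowerVars P L i ∨ d = (GVar.am i, 0)) ∧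
      f = MvPolynomial.C c * X (GVar.b i, 1) + p := by
  classical
  obtain ⟨-, c, hc, q, hq, rfl⟩ := hf
  refine ⟨c, hc, MvPolynomial.C c * (X (GVar.am i, 0) + q), fun d hd => ?_, by ring⟩
  rw [vars_C_mul _ hc] at hd
  rcases Finset.mem_union.1 (vars_add_subset _ _ hd) with h | h
  · rw [vars_X, Finset.mem_singleton] at h; exact Or.inr h
  · exact Or.inl (mem_supported.1 hq h)

theorem HasShape.lead_notMem {i : Fin m} {p : DPoly C (GVar l m)}
    (hp : ∀ d ∈ p.vars, d ∈ lowerVars P L i ∨ d = (GVar.am i, 0)) : (GVar.b i, 1) ∉ p.vars := by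
  intro h
  rcases hp _ h with h | h
  · exact (lead_notMem_lowerVars i 0).1 h
  · simp at h

theorem HasShape.isLeader (hrk : IsAdapted P rk) {i : Fin m} {f : DPoly C (GVar l m)}
    (hf : HasShape P L i f) : IsLeader rk f (GVar.b i, 1) := by
  classical
  obtain ⟨c, hc, p, hp, rfl⟩ := hf.exists_linear
  refine ⟨mem_vars_linear hc (HasShape.lead_notMem hp), fun e he hne => ?_⟩
  rcases Finset.mem_union.1 (vars_add_subset _ _ he) with h | h
  · rw [vars_C_mul _ hc, vars_X, Finset.mem_singleton] at h; exact absurd h hne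
  · rcases hp _ h with h | rfl
    · exact lt_of_mem_lowerVars hrk h
    · exact hrk.elim_am _ _ _ _

theorem HasShape.degree_initial_separant {i : Fin m} {f : DPoly C (GVar l m)}
    (hf : HasShape P L i f) : f.degreeOf (GVar.b i, 1) = 1 ∧ ∃ c : C, c ≠ 0 ∧
      initialAt f (GVar.b i, 1) = MvPolynomial.C c ∧
      separantAt f (GVar.b i, 1) = MvPolynomial.C c := by
  obtain ⟨c, hc, p, hp, rfl⟩ := hf.exists_linear
  have h := HasShape.lead_notMem hp
  exact ⟨degreeOf_linear hc h, c, hc, initialAt_linear hc h, separantAt_linear h⟩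

theorem HasShape.am_notMem {i : Fin m} {f : DPoly C (GVar l m)} (hf : HasShape P L i f) :
    (∃ c : C, c ≠ 0 ∧ ∀ k : ℕ, (GVar.am i, k) ∉
      (f - MvPolynomial.C c * X (GVar.am i, 0)).vars) ∧
    ∀ j : Fin m, j ≠ i → P.height i ≤ P.height j → ∀ k : ℕ, (GVar.am j, k) ∉ f.vars := by
  classical
  constructor
  · obtain ⟨-, c, hc, q, hq, rfl⟩ := hf
    refine ⟨c, hc, fun k hk => ?_⟩
    have : MvPolynomial.C c * (X (GVar.b i, 1) + (X (GVar.am i, 0) + q)) -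
      MvPolynomial.C c * X (GVar.am i, 0) = MvPolynomial.C c * (X (GVar.b i, 1) + q) := by ring
    rw [this, vars_C_mul _ hc] at hk
    rcases Finset.mem_union.1 (vars_add_subset _ _ hk) with h | h
    · rw [vars_X, Finset.mem_singleton] at h; simp at h
    · exact (lead_notMem_lowerVars i k).2 (mem_supported.1 hq h)
  · obtain ⟨c, hc, p, hp, rfl⟩ := hf.exists_linear
    intro j hj hle k hk
    rcases Finset.mem_union.1 (vars_add_subset _ _ hk) with h | h
    · rw [vars_C_mul _ hc, vars_X, Finset.mem_singleton] at h; simp at h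
    · rcases hp _ h with h | h
      · exact absurd (h.2.2.2 j rfl) (not_lt.2 hle)
      · simp [hj] at h

section System

variable {ι : Type*} {f : ι → DPoly C (GVar l m)} {idx : ι → Fin m}

/-- The leaders are first derivatives of pairwise different indeterminates, so none is a derivative
of another. Initials and separants are nonzero constants, hence vanish at no point at all. -/
theorem isSimpleSystem_of_hasShape [Finite ι] (hrk : IsAdapted P rk)
    (hidx : Function.Injective idx) (hf : ∀ r, HasShape P L (idx r) (f r)) :
    IsSimpleSystem rk f (fun j : Empty => j.elim) := by
  have hl : ∀ {r d}, IsLeader rk (f r) d → d = (GVar.b (idx r), 1) := fun {r d} h =>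
    h.unique ((hf r).isLeader hrk)
  have hinj : ∀ {r s : ι} {j k : ℕ}, ((GVar.b (idx r) : GVar l m), j) = (GVar.b (idx s), k) → r = s :=
    fun h => hidx (by simpa using (Prod.mk.inj h).1)
  refine ⟨inferInstance, inferInstance, fun r c h => ?_, fun j => j.elim, fun r s d h1 h2 => ?_,
    fun j => j.elim, fun _ j => j.elim, fun x _ _ => ⟨fun r d hd => ?_, fun j => j.elim⟩,
    fun r s hrs h => ?_, fun j => j.elim⟩
  · have := ((hf r).isLeader hrk).1
    rw [h, vars_C] at this
    exact absurd this (Finset.notMem_empty _)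
  · exact hinj ((hl h1).symm.trans (hl h2))
  · obtain ⟨-, c, hc, h1, h2⟩ := (hf r).degree_initial_separant
    rw [hl hd, h1, h2]
    simpa using hc
  · obtain ⟨d, e, k, hd, he, hde, -⟩ := h
    rw [hl hd, hl he] at hde
    exact hrs (hinj hde)

/-- A weight on the derivatives, for which the derivatives of equations with leaders `b_i'` are
triangular. -/
def triWeight (P : RootEnum G l m) (d : GVar l m × ℕ) : ℕ :=
  match d.1 with
  -- The factor exceeds every height, so the order decides first and the height breaks ties. The
  -- ranking itself cannot serve as an ℕ-valued measure, since each b lies above infinitely many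
  -- derivatives of the a's.
  | GVar.b k => d.2 * (∑ j, P.height j + 1) + P.height k
  | _ => 0

theorem height_le_sum (P : RootEnum G l m) (k : Fin m) : P.height k ≤ ∑ j, P.height j :=
  Finset.single_le_sum (f := P.height) (fun _ _ => Nat.zero_le _) (Finset.mem_univ k)

/-- Differentiation raises the weight of every derivative of a b by the same amount, the leader
included, and leaves the a's at weight 0. Strict inequality therefore persists from the case k = 0.
-/
theorem iterate_delta_mem_of_lowerVars (i : Fin m) {q : DPoly C (GVar l m)}
    (hq : ∀ d ∈ q.vars, d ∈ lowerVars P L i ∨ d = (GVar.am i, 0)) (k : ℕ) :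
    (delta C (GVar l m))^[k] q ∈
      supported C ({d | d.1 ∈ varsOf L} ∩ {d | triWeight P d < triWeight P (GVar.b i, k + 1)}) := by
  induction k with
  | zero =>
    refine mem_supported.2 fun d hd => ?_
    rcases hq d hd with ⟨h1, h2, h3, -⟩ | rfl
    · refine ⟨h1, ?_⟩
      obtain ⟨v, j⟩ := d
      cases v with
      | b k =>
        simp only [triWeight, Set.mem_ofPred_eq] at *
        have := height_le_sum P k
        rcases Nat.le_one_iff_eq_zero_or_eq_one.1 h2 with rfl | rfl
        · omega
        · obtain ⟨k', hk', h⟩ := h3 rfl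
          obtain rfl : k = k' := by simpa using hk'
          omega
      | _ => simp only [triWeight, Set.mem_ofPred_eq]; omega
    · refine ⟨fun i hi => by simp at hi, ?_⟩
      simp only [triWeight, Set.mem_ofPred_eq]; omega
  | succ k ih =>
    rw [Function.iterate_succ_apply']
    refine delta_mem_supported (fun d hd => ?_) (fun d hd => ?_) ih
    · refine ⟨hd.1, lt_of_lt_of_le (b := triWeight P (GVar.b i, k + 1)) hd.2 ?_⟩
      simp only [triWeight]; gcongr; omega
    · refine ⟨hd.1, ?_⟩
      have hd2 := hd.2
      obtain ⟨v, j⟩ := d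
      cases v with
      | b s => simp only [triWeight, Set.mem_ofPred_eq, add_mul, one_mul] at *; omega
      | _ => simp only [triWeight, Set.mem_ofPred_eq, add_mul]; omega

/-- The derivatives of the equations, divided by their constants, form a triangular family indexed
by `ι × ℕ`. The abstract `A` covers both C{a⁺, a⁻, a⁰, b} and its subring with b_w. -/
theorem isPrime_of_hasShape {A : Type*} [CommRing A] [Algebra C A]
    (emb : A →ₐ[C] DPoly C (GVar l m)) (hemb : Function.Injective emb) (W : Set (GVar l m × ℕ))
    (hW : emb.range = supported C W) (hLW : {d | d.1 ∈ varsOf L} ⊆ W)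
    (hidx : Function.Injective idx) (hf : ∀ r, HasShape P L (idx r) (f r)) :
    (Ideal.span {g : A | ∃ p ∈ Set.range f, ∃ k : ℕ, emb g = (delta C (GVar l m))^[k] p}).IsPrime := by
  choose c hc p hp hfp using fun r => (hf r).exists_linear
  -- This is what the r.2-th derivative of the equation gives when solved for its leading variable.
  -- The summand `0` only matches the form of `iterate_delta_C_mul_add`.
  let h : ι × ℕ → DPoly C (GVar l m) := fun r =>
    (delta C (GVar l m))^[r.2] (MvPolynomial.C (-(c r.1)⁻¹) * (p r.1 + 0))
  have hh : ∀ r : ι × ℕ, ∀ t ∈ (h r).vars, t.1 ∈ varsOf L ∧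
      triWeight P t < triWeight P (GVar.b (idx r.1), r.2 + 1) := fun r t ht => by
    refine mem_supported.1 (iterate_delta_mem_of_lowerVars (L := L) (idx r.1) (fun d hd => ?_) r.2) ht
    rw [vars_C_mul _ (neg_ne_zero.2 (inv_ne_zero (hc _))), add_zero] at hd
    exact hp _ _ hd
  refine isPrime_of_triangular (μ := triWeight P) (c := fun r => c r.1)
    (lead := fun r : ι × ℕ => ((GVar.b (idx r.1), r.2 + 1) : GVar l m × ℕ)) (h := h) emb hemb W hW
    (fun r s hrs => ?_) (fun r t ht => (hh r t ht).2)
    (fun r t ht => hLW (hh r t ht).1) (fun r => hc _) _ fun g => ?_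
  · simp only [Prod.mk.injEq, GVar.b.injEq, add_left_inj] at hrs
    exact Prod.ext (hidx hrs.1) hrs.2
  · have key : ∀ r k, (delta C (GVar l m))^[k] (f r) =
        MvPolynomial.C (c r) * (X (GVar.b (idx r), k + 1) - h (r, k)) := by
      intro r k
      have h0 : f r = MvPolynomial.C (c r) * (X (GVar.b (idx r), 1) +
          MvPolynomial.C (c r)⁻¹ * (p r + 0)) := by
        rw [mul_add, ← mul_assoc, ← C_mul, mul_inv_cancel₀ (hc r), C_1, one_mul, add_zero]
        exact hfp r
      rw [h0, iterate_delta_C_mul_add, iterate_delta_X, iterate_delta_C_mul_add, add_comm 1 k]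
      simp only [h]
      rw [iterate_delta_C_mul_add, C_neg]
      ring
    constructor
    · rintro ⟨-, ⟨r, rfl⟩, k, hk⟩
      exact ⟨(r, k), hk.trans (key r k)⟩
    · rintro ⟨⟨r, k⟩, hk⟩
      exact ⟨f r, ⟨r, rfl⟩, k, hk.trans (key r k).symm⟩

theorem isPrime_diffIdeal_of_hasShape (hidx : Function.Injective idx)
    (hf : ∀ r, HasShape P L (idx r) (f r)) : (diffIdeal (Set.range f)).IsPrime :=
  isPrime_of_hasShape (AlgHom.id C _) Function.injective_id Set.univ
    (by rw [supported_univ]; exact (AlgHom.range_eq_top _).2 Function.surjective_id) (Set.subset_univ _) hidx hf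

theorem isPrime_diffIdealIn_of_hasShape (hidx : Function.Injective idx)
    (hf : ∀ r, HasShape P L (idx r) (f r)) : (diffIdealIn (varsOf L) (Set.range f)).IsPrime :=
  isPrime_of_hasShape (subring C (varsOf L)).val Subtype.val_injective {d | d.1 ∈ varsOf L}
    (Subalgebra.range_val _) subset_rfl hidx hf

end System

end

end

/-! ### Weight spaces, heights and the Chevalley basis -/

noncomputable section

open DiffAlg MvPolynomial ClassicalGroup

namespace ClassicalGroup

section

variable {C : Type*} [Field C] {N : ℕ} {G : ClassicalGroup C N}

theorem lie_mem_lieAlg {M M' : Matrix (Fin N) (Fin N) C} (h : M ∈ G.lieAlg) (h' : M' ∈ G.lieAlg) :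
    M * M' - M' * M ∈ G.lieAlg := by
  have skew : ∀ J : Matrix (Fin N) (Fin N) C, M ∈ skewAdjointMatricesSubmodule J →
      M' ∈ skewAdjointMatricesSubmodule J → M * M' - M' * M ∈ skewAdjointMatricesSubmodule J := by
    intro J h h'
    exact Matrix.isSkewAdjoint_bracket J h h'
  cases G with
  | SL =>
    rw [lieAlg, LinearMap.mem_ker, map_sub, Matrix.traceLinearMap_apply, Matrix.traceLinearMap_apply,
      Matrix.trace_mul_comm, sub_self]
  | Sp J hJ hs => exact skew J h h'
  | SO J hJ hs => exact skew J h h'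

theorem lie_mem_weightSpace {β γ : G.Wt} {M M' : Matrix (Fin N) (Fin N) C}
    (h : M ∈ G.weightSpace β) (h' : M' ∈ G.weightSpace γ) :
    M * M' - M' * M ∈ G.weightSpace (β + γ) := by
  refine ⟨lie_mem_lieAlg h.1 h'.1, fun H => ?_⟩
  have h1 := h.2 H
  have h2 := h'.2 H
  rw [sub_eq_iff_eq_add] at h1 h2
  rw [mul_sub, sub_mul, ← mul_assoc, h1, ← mul_assoc, h2, add_mul, add_mul, mul_assoc M _ M', h2,
    mul_assoc M' _ M, h1, LinearMap.add_apply, mul_add, mul_add]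
  simp only [Matrix.smul_mul, Matrix.mul_smul, add_smul, smul_sub, mul_assoc]
  abel

theorem conj_mem_lieAlg {g : GL (Fin N) C} (hg : g ∈ G.group) {M : Matrix (Fin N) (Fin N) C}
    (h : M ∈ G.lieAlg) :
    (g : Matrix (Fin N) (Fin N) C) * M * ((g⁻¹ : GL (Fin N) C) : Matrix (Fin N) (Fin N) C) ∈
      G.lieAlg := by
  have h1 : (g : Matrix (Fin N) (Fin N) C) * ((g⁻¹ : GL (Fin N) C) : Matrix (Fin N) (Fin N) C) = 1 := by
    rw [← Units.val_mul]; simp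
  have h2 : ((g⁻¹ : GL (Fin N) C) : Matrix (Fin N) (Fin N) C) * (g : Matrix (Fin N) (Fin N) C) = 1 := by
    rw [← Units.val_mul]; simp
  have skew : ∀ J : Matrix (Fin N) (Fin N) C, g ∈ isometries J →
      M ∈ skewAdjointMatricesSubmodule J → (g : Matrix (Fin N) (Fin N) C) * M *
        ((g⁻¹ : GL (Fin N) C) : Matrix (Fin N) (Fin N) C) ∈ skewAdjointMatricesSubmodule J := by
    intro J hg h
    have hg' : ((g⁻¹ : GL (Fin N) C) : Matrix (Fin N) (Fin N) C).transpose * J *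
      ((g⁻¹ : GL (Fin N) C) : Matrix (Fin N) (Fin N) C) = J := inv_mem hg
    have hg'' : (g : Matrix (Fin N) (Fin N) C).transpose * J * g = J := hg
    rw [mem_skewAdjointMatricesSubmodule] at *
    unfold Matrix.IsSkewAdjoint Matrix.IsAdjointPair at *
    generalize (g : Matrix (Fin N) (Fin N) C) = a at *
    generalize ((g⁻¹ : GL (Fin N) C) : Matrix (Fin N) (Fin N) C) = b at *
    have h3 : a.transpose * J = J * b := by
      calc a.transpose * J = a.transpose * J * (a * b) := by rw [h1, mul_one]
        _ = J * b := by rw [← mul_assoc, hg'']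
    have h4 : b.transpose * J = J * a := by
      calc b.transpose * J = b.transpose * J * (b * a) := by rw [h2, mul_one]
        _ = J * a := by rw [← mul_assoc, hg']
    rw [Matrix.transpose_mul, Matrix.transpose_mul, mul_assoc, mul_assoc, h3,
      ← mul_assoc M.transpose, h, mul_assoc J, ← mul_assoc, h4]
    simp [mul_assoc]
  cases G with
  | SL =>
    rw [lieAlg, LinearMap.mem_ker, Matrix.traceLinearMap_apply] at *
    rw [Matrix.trace_mul_comm, ← mul_assoc, h2, one_mul, h]
  | Sp J hJ hs => exact skew J hg h
  | SO J hJ hs => exact skew J hg.1 h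

/-- Leibniz rule for [H, ·]. It is an identity of matrices: the power need not lie in 𝔤. -/
theorem pow_weight {β : G.Wt} {M : Matrix (Fin N) (Fin N) C} (hM : M ∈ G.weightSpace β)
    (H : G.cartan) (k : ℕ) :
    (H : Matrix (Fin N) (Fin N) C) * M ^ k - M ^ k * H = ((k : C) * β H) • M ^ k := by
  induction k with
  | zero => simp
  | succ k ih =>
    rw [sub_eq_iff_eq_add] at ih
    have h1 := hM.2 H
    rw [sub_eq_iff_eq_add] at h1
    rw [pow_succ, ← mul_assoc, ih, add_mul, mul_assoc (M ^ k) _ M, h1, mul_add, sub_eq_iff_eq_add,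
      Matrix.smul_mul, Matrix.mul_smul, mul_assoc, ← add_assoc, ← add_smul]
    push_cast
    ring_nf

/-- Root vectors are nilpotent. -/
theorem isNilpotent_of_mem_weightSpace [CharZero C] {β : G.Wt} (hβ : β ≠ 0)
    {M : Matrix (Fin N) (Fin N) C} (hM : M ∈ G.weightSpace β) : IsNilpotent M := by
  obtain ⟨H, hH⟩ : ∃ H, β H ≠ 0 := by
    by_contra! h
    exact hβ (LinearMap.ext h)
  -- As H is diagonal, [H, ·] has only these finitely many eigenvalues. In characteristic zero the
  -- multiples kβ(H) are infinitely many, so some power of `M` has a non-eigenvalue as weight and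
  -- vanishes.
  let D : Set C := Set.range fun ij : Fin N × Fin N =>
    ((H : Matrix (Fin N) (Fin N) C) ij.1 ij.1 - (H : Matrix (Fin N) (Fin N) C) ij.2 ij.2)
  have hinj : Function.Injective fun k : ℕ => (k : C) * β H := fun a b hab =>
    Nat.cast_injective (mul_right_cancel₀ hH hab)
  obtain ⟨k, hk⟩ : ∃ k : ℕ, (k : C) * β H ∉ D := by
    by_contra! h
    exact Set.infinite_range_of_injective hinj
      ((Set.finite_range _).subset (by rintro _ ⟨k, rfl⟩; exact h k))
  refine ⟨k, Matrix.ext fun i j => ?_⟩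
  have h1 := congrFun (congrFun (pow_weight hM H k) i) j
  have h2 := H.2.2.diagonal_diag
  rw [Matrix.sub_apply, ← h2, Matrix.diagonal_mul, Matrix.mul_diagonal, Matrix.smul_apply,
    smul_eq_mul, mul_comm ((M ^ k) i j), ← sub_mul, ← sub_eq_zero, ← sub_mul] at h1
  rcases mul_eq_zero.1 h1 with h | h
  · exact absurd ⟨(i, j), sub_eq_zero.1 h⟩ hk
  · exact h

/-- `Represents` evaluates `w γ` only on conjugates of elements of 𝔥. Conjugation is linear and
injective on the finite-dimensional 𝔥, hence surjective, so every element of 𝔥 is such a conjugate.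
-/
theorem conj_mem_weightSpace {g : GL (Fin N) C} {w : G.Wt ≃ₗ[C] G.Wt} (hg : Represents G g w)
    {γ : G.Wt} {M : Matrix (Fin N) (Fin N) C} (h : M ∈ G.weightSpace γ) :
    (g : Matrix (Fin N) (Fin N) C) * M * ((g⁻¹ : GL (Fin N) C) : Matrix (Fin N) (Fin N) C) ∈
      G.weightSpace (w γ) := by
  have h1 : (g : Matrix (Fin N) (Fin N) C) * ((g⁻¹ : GL (Fin N) C) : Matrix (Fin N) (Fin N) C) = 1 := by
    rw [← Units.val_mul]; simp
  have h2 : ((g⁻¹ : GL (Fin N) C) : Matrix (Fin N) (Fin N) C) * (g : Matrix (Fin N) (Fin N) C) = 1 := by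
    rw [← Units.val_mul]; simp
  obtain ⟨hgG, -, hH⟩ := hg
  choose T hT hw using hH
  let Tl : G.cartan →ₗ[C] G.cartan :=
    { toFun := T
      map_add' := fun x y => Subtype.ext (by
        rw [Submodule.coe_add, hT, hT, hT, Submodule.coe_add, mul_add, add_mul])
      map_smul' := fun c x => Subtype.ext (by
        rw [RingHom.id_apply, Submodule.coe_smul, hT, hT, Submodule.coe_smul, Matrix.mul_smul,
          Matrix.smul_mul]) }
  have hinj : Function.Injective Tl := fun x y hxy => by
    have := congrArg (Subtype.val) (show T x = T y from hxy)
    rw [hT, hT] at this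
    apply Subtype.ext
    calc (x : Matrix (Fin N) (Fin N) C) = ((g⁻¹ : GL (Fin N) C) : Matrix (Fin N) (Fin N) C) *
          ((g : Matrix (Fin N) (Fin N) C) * x * ((g⁻¹ : GL (Fin N) C) : Matrix (Fin N) (Fin N) C)) * g := by
            rw [mul_assoc _ _ (g : Matrix (Fin N) (Fin N) C), mul_assoc _ _ (g : Matrix (Fin N) (Fin N) C),
              h2, mul_one, ← mul_assoc, h2, one_mul]
      _ = y := by
            rw [this, mul_assoc _ _ (g : Matrix (Fin N) (Fin N) C),
              mul_assoc _ _ (g : Matrix (Fin N) (Fin N) C), h2, mul_one, ← mul_assoc, h2, one_mul]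
  refine ⟨conj_mem_lieAlg hgG h.1, fun H' => ?_⟩
  obtain ⟨H, rfl⟩ := (LinearMap.injective_iff_surjective.1 hinj) H'
  change (T H : Matrix (Fin N) (Fin N) C) * _ - _ * (T H : Matrix (Fin N) (Fin N) C) = (w γ) (T H) • _
  rw [hw, hT, ← Matrix.smul_mul, ← Matrix.mul_smul, ← h.2 H, mul_sub, sub_mul]
  generalize (g : Matrix (Fin N) (Fin N) C) = a at *
  generalize ((g⁻¹ : GL (Fin N) C) : Matrix (Fin N) (Fin N) C) = b at *
  have e : ∀ x y : Matrix (Fin N) (Fin N) C, a * x * b * (a * y * b) = a * (x * y) * b := fun x y => by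
    calc _ = a * x * (b * a) * y * b := by simp only [mul_assoc]
      _ = _ := by rw [h2, mul_one]; simp only [mul_assoc]
  rw [e, e]

end

end ClassicalGroup

namespace RootEnum

section

variable {C : Type*} [Field C] {N : ℕ} {G : ClassicalGroup C N} {l m : ℕ} (P : RootEnum G l m)

theorem isRoot_root (i : Fin m) : G.IsRoot (P.root i) := (P.isRoot_iff _).2 ⟨i, Or.inl rfl⟩

theorem isRoot_neg_root (i : Fin m) : G.IsRoot (-P.root i) := (P.isRoot_iff _).2 ⟨i, Or.inr rfl⟩

/-- The weights of the members of a Chevalley basis. -/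
def weight : Fin l ⊕ (Fin m ⊕ Fin m) → G.Wt :=
  Sum.elim (fun _ => 0) (Sum.elim P.root fun i => -P.root i)

/-- The heights of the members of a Chevalley basis. -/
def weightHeight : Fin l ⊕ (Fin m ⊕ Fin m) → ℤ :=
  Sum.elim (fun _ => 0) (Sum.elim (fun i => (P.height i : ℤ)) fun i => -(P.height i : ℤ))

/-- The simple roots are independent, so some functional takes the value 1 on each. It makes height
additive in weights, and characteristic zero brings equalities back to the integers. -/
theorem exists_heightFunctional :
    ∃ ℓ : G.Wt →ₗ[C] C, ∀ k, ℓ (P.weight k) = (P.weightHeight k : C) := by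
  obtain ⟨ℓ, hℓ⟩ := LinearMap.exists_extend
    ((Module.Basis.span P.simple_indep).constr C fun _ => (1 : C))
  have hs : ∀ j : Fin l, ℓ (P.root (Fin.castLE P.le j)) = 1 := fun j => by
    have h1 := LinearMap.congr_fun hℓ (Module.Basis.span P.simple_indep j)
    rw [Module.Basis.constr_basis, LinearMap.comp_apply, Submodule.subtype_apply,
      Module.Basis.span_apply] at h1
    exact h1
  have hr : ∀ i, ℓ (P.root i) = (P.height i : C) := fun i => by
    rw [P.root_eq i, map_sum, height, Nat.cast_sum]
    refine Finset.sum_congr rfl fun j _ => ?_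
    rw [map_nsmul, hs, nsmul_one]
  refine ⟨ℓ, ?_⟩
  rintro (k | k | k)
  · simp [weight, weightHeight]
  · simp [weight, weightHeight, hr]
  · simp [weight, weightHeight, hr]

theorem height_pos (i : Fin m) : 0 < P.height i := by
  refine Nat.pos_of_ne_zero fun h => (P.isRoot_root i).1 ?_
  rw [P.root_eq i]
  refine Finset.sum_eq_zero fun j hj => ?_
  rw [Finset.sum_eq_zero_iff.1 h j hj, zero_smul]

theorem root_ne_neg_root [CharZero C] (i j : Fin m) : P.root i ≠ -P.root j := by
  obtain ⟨ℓ, hℓ⟩ := P.exists_heightFunctional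
  intro h
  have h1 := hℓ (Sum.inr (Sum.inl i))
  have h2 := hℓ (Sum.inr (Sum.inr j))
  simp only [weight, weightHeight, Sum.elim_inr, Sum.elim_inl] at h1 h2
  rw [h, h2] at h1
  have := P.height_pos i
  have := P.height_pos j
  have h3 := Int.cast_injective h1
  omega

/-- Together with `weightSpace_le_span` this says that root spaces are lines. -/
theorem weight_eq_root [CharZero C] {k : Fin l ⊕ (Fin m ⊕ Fin m)} {i : Fin m}
    (h : P.weight k = P.root i) : k = Sum.inr (Sum.inl i) := by
  rcases k with k | k | k
  · exact absurd h.symm (P.isRoot_root i).1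
  · rw [P.root_inj h]
  · exact absurd h.symm (P.root_ne_neg_root _ _)

theorem weight_eq_neg_root [CharZero C] {k : Fin l ⊕ (Fin m ⊕ Fin m)} {i : Fin m}
    (h : P.weight k = -P.root i) : k = Sum.inr (Sum.inr i) := by
  rcases k with k | k | k
  · exact absurd h.symm (P.isRoot_neg_root i).1
  · exact absurd h (P.root_ne_neg_root _ _)
  · rw [P.root_inj (neg_injective h)]

end

end RootEnum

namespace ChevalleyBasis

section

variable {C : Type*} [Field C] {N : ℕ} {G : ClassicalGroup C N} {l m : ℕ} {P : RootEnum G l m}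
  (B : ChevalleyBasis P)

/-- The Chevalley basis as a family. -/
def vec : Fin l ⊕ (Fin m ⊕ Fin m) → Matrix (Fin N) (Fin N) C :=
  Sum.elim (fun j => (B.H j : Matrix (Fin N) (Fin N) C))
    (Sum.elim (fun i => B.X (P.root i)) (fun i => B.X (-P.root i)))

theorem vec_mem_weightSpace (k) : B.vec k ∈ G.weightSpace (P.weight k) := by
  rcases k with k | k | k
  · refine ⟨(B.H k).2.1, fun H => ?_⟩
    have h1 := H.2.2.diagonal_diag
    have h2 := (B.H k).2.2.diagonal_diag
    simp only [vec, Sum.elim_inl, RootEnum.weight]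
    rw [← h1, ← h2, Matrix.diagonal_mul_diagonal, Matrix.diagonal_mul_diagonal]
    simp [mul_comm]
  · exact B.X_mem _ (P.isRoot_root k)
  · exact B.X_mem _ (P.isRoot_neg_root k)

/-- The basis diagonalizes every [H, ·], so by independence a nonzero coefficient forces its basis
element to have weight γ. -/
theorem weightSpace_le_span (γ : G.Wt) :
    G.weightSpace γ ≤ Submodule.span C (B.vec '' {k | P.weight k = γ}) := by
  intro M hM
  have h1 : M ∈ Submodule.span C (Set.range B.vec) := B.span_eq.symm ▸ hM.1
  obtain ⟨c, rfl⟩ := (Submodule.mem_span_range_iff_exists_fun C).1 h1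
  refine Submodule.sum_mem _ fun k _ => ?_
  by_cases hk : P.weight k = γ
  · exact Submodule.smul_mem _ _ (Submodule.subset_span ⟨k, hk, rfl⟩)
  · suffices c k = 0 by rw [this, zero_smul]; exact zero_mem _
    by_contra hc
    refine hk (LinearMap.ext fun H => ?_)
    have h2 := hM.2 H
    rw [Finset.mul_sum, Finset.sum_mul, ← Finset.sum_sub_distrib, Finset.smul_sum, ← sub_eq_zero,
      ← Finset.sum_sub_distrib] at h2
    have h3 : ∀ k, (H : Matrix (Fin N) (Fin N) C) * c k • B.vec k - c k • B.vec k * H -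
        γ H • c k • B.vec k = (c k * (P.weight k H - γ H)) • B.vec k := fun k => by
      rw [Matrix.mul_smul, Matrix.smul_mul, ← smul_sub, (B.vec_mem_weightSpace k).2 H, smul_smul,
        smul_smul, ← sub_smul]
      ring_nf
    simp only [h3] at h2
    have h4 := Fintype.linearIndependent_iff.1 B.indep _ h2 k
    exact sub_eq_zero.1 ((mul_eq_zero.1 h4).resolve_left hc)

end

end ChevalleyBasis

end

/-! ### Exponentials: conjugation and logarithmic derivative -/

noncomputable section

open DiffAlg MvPolynomial ClassicalGroup

namespace IsNilpotent

/-- Conjugation by `exp a` is `exp (ad a)`. -/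
theorem exp_mul_mul_exp_neg {A : Type*} [Ring A] [Algebra ℚ A] {a : A} (ha : IsNilpotent a) (z : A) :
    ∃ k, exp a * z * exp (-a) = ∑ i ∈ Finset.range (k + 1),
      (i.factorial : ℚ)⁻¹ • (((LinearMap.mulLeft ℚ a - LinearMap.mulRight ℚ a) ^ i) z) := by
  have hl : IsNilpotent (LinearMap.mulLeft ℚ a) := by
    obtain ⟨k, hk⟩ := ha
    exact ⟨k, by rw [LinearMap.pow_mulLeft, hk, LinearMap.mulLeft_zero_eq_zero]⟩
  have hr : IsNilpotent (LinearMap.mulRight ℚ (-a)) := by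
    obtain ⟨k, hk⟩ := ha.neg
    exact ⟨k, by rw [LinearMap.pow_mulRight, hk, LinearMap.mulRight_zero_eq_zero]⟩
  have hc : Commute (LinearMap.mulLeft ℚ a) (LinearMap.mulRight ℚ (-a)) :=
    LinearMap.commute_mulLeft_right a (-a)
  have hel : exp (LinearMap.mulLeft ℚ a) = LinearMap.mulLeft ℚ (exp a) := by
    obtain ⟨k, hk⟩ := ha
    rw [exp_eq_sum hk, exp_eq_sum (k := k) (by
      rw [LinearMap.pow_mulLeft, hk, LinearMap.mulLeft_zero_eq_zero])]
    ext x
    simp [LinearMap.pow_mulLeft, Finset.sum_mul]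
  have her : exp (LinearMap.mulRight ℚ (-a)) = LinearMap.mulRight ℚ (exp (-a)) := by
    obtain ⟨k, hk⟩ := ha.neg
    rw [exp_eq_sum hk, exp_eq_sum (k := k) (by
      rw [LinearMap.pow_mulRight, hk, LinearMap.mulRight_zero_eq_zero])]
    ext x
    simp [LinearMap.pow_mulRight, Finset.mul_sum]
  have hsub : LinearMap.mulLeft ℚ a - LinearMap.mulRight ℚ a =
      LinearMap.mulLeft ℚ a + LinearMap.mulRight ℚ (-a) := by
    ext x; simp [sub_eq_add_neg]
  -- Summing over `k + 1` terms guarantees that the term `i = 0`, which is `z` itself, is present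
  -- and can be split off.
  obtain ⟨k, hk⟩ := hc.isNilpotent_add hl hr
  refine ⟨k, ?_⟩
  have := LinearMap.congr_fun (exp_add_of_commute hc hl hr) z
  rw [hel, her, exp_eq_sum (pow_eq_zero_of_le k.le_succ hk), Module.End.mul_apply, LinearMap.mulLeft_apply,
    LinearMap.mulRight_apply, ← mul_assoc] at this
  rw [hsub, ← this, LinearMap.sum_apply]
  rfl

end IsNilpotent

namespace DiffAlg

section

variable {C V : Type*} [Field C] {N : ℕ}

theorem const_mul (M M' : Matrix (Fin N) (Fin N) C) : const V (M * M') = const V M * const V M' :=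
  Matrix.map_mul

theorem const_add (M M' : Matrix (Fin N) (Fin N) C) : const V (M + M') = const V M + const V M' :=
  Matrix.map_add _ (fun _ _ => C_add) _ _

theorem const_sub (M M' : Matrix (Fin N) (Fin N) C) : const V (M - M') = const V M - const V M' :=
  Matrix.map_sub _ (fun _ _ => C_sub _ _ _) _ _

theorem const_one : const V (1 : Matrix (Fin N) (Fin N) C) = 1 :=
  Matrix.map_one _ C_0 C_1

theorem const_zero : const V (0 : Matrix (Fin N) (Fin N) C) = 0 :=
  Matrix.map_zero _ C_0

theorem const_smul (c : C) (M : Matrix (Fin N) (Fin N) C) :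
    const V (c • M) = (MvPolynomial.C c : DPoly C V) • const V M := by
  ext i j : 1; simp [const]

theorem const_sum {ι : Type*} (s : Finset ι) (f : ι → Matrix (Fin N) (Fin N) C) :
    const V (∑ i ∈ s, f i) = ∑ i ∈ s, const V (f i) := by
  induction s using Finset.cons_induction with
  | empty => simp [const_zero]
  | cons a s ha ih => rw [Finset.sum_cons, Finset.sum_cons, const_add, ih]

theorem const_pow (M : Matrix (Fin N) (Fin N) C) (k : ℕ) : const V (M ^ k) = const V M ^ k := by
  induction k with
  | zero => rw [pow_zero, pow_zero, const_one]
  | succ k ih => rw [pow_succ, pow_succ, const_mul, ih]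

theorem map_delta_const (M : Matrix (Fin N) (Fin N) C) : (const V M).map (delta C V) = 0 := by
  ext i j : 1
  simp only [const, Matrix.map_apply, Matrix.zero_apply]
  exact (delta C V).map_algebraMap _

theorem map_delta_mul (M M' : Matrix (Fin N) (Fin N) (DPoly C V)) :
    (M * M').map (delta C V) = M.map (delta C V) * M' + M * M'.map (delta C V) := by
  ext i j : 1
  simp only [Matrix.map_apply, Matrix.mul_apply, Matrix.add_apply, map_sum, Derivation.leibniz,
    smul_eq_mul, ← Finset.sum_add_distrib]
  refine Finset.sum_congr rfl fun k _ => by ring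

theorem map_delta_smul_const (f : DPoly C V) (M : Matrix (Fin N) (Fin N) C) :
    (f • const V M).map (delta C V) = delta C V f • const V M := by
  ext i j : 1
  simp only [const, Matrix.map_apply, Matrix.smul_apply, smul_eq_mul, Derivation.leibniz]
  rw [show delta C V (MvPolynomial.C (M i j)) = 0 from (delta C V).map_algebraMap _]
  ring

/-- Taking the coefficient of one monomial at a time yields linear relations over C. -/
theorem linearIndependent_const {ι : Type*} [Fintype ι] {v : ι → Matrix (Fin N) (Fin N) C}
    (hv : LinearIndependent C v) {x : ι → DPoly C V} (hx : ∑ k, x k • const V (v k) = 0) : x = 0 := by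
  funext k
  ext s
  refine Fintype.linearIndependent_iff.1 hv (fun k => (x k).coeff s) ?_ k
  ext i j
  have h := congrArg (coeff s) (congrFun (congrFun hx i) j)
  simpa [const, Matrix.sum_apply, coeff_sum, mul_comm _ (MvPolynomial.C _), coeff_C_mul, mul_comm _ (v _ i j)] using h

/-- The logarithmic derivative of `exp (f X)` for a nilpotent constant matrix `X`. -/
theorem map_delta_exp [CharZero C] (f : DPoly C V) {M : Matrix (Fin N) (Fin N) C}
    (hM : IsNilpotent M) : (IsNilpotent.exp (f • const V M)).map (delta C V) =
      (delta C V f • const V M) * IsNilpotent.exp (f • const V M) := by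
  obtain ⟨k, hk⟩ := hM
  have hk1 : (f • const V M) ^ k = 0 := by rw [smul_pow, ← const_pow, hk, const_zero, smul_zero]
  -- Truncating one term late absorbs the index shift: differentiation kills the constant term, and
  -- the extra last term on the right vanishes by `hk1`.
  have hk2 : (f • const V M) ^ (k + 1) = 0 := by rw [pow_succ, hk1, zero_mul]
  have hmap : ∀ (q : ℚ) (Z : Matrix (Fin N) (Fin N) (DPoly C V)),
      (q • Z).map (delta C V) = q • Z.map (delta C V) := fun q Z => by
    ext i j : 1
    simp only [Matrix.map_apply, Matrix.smul_apply, map_rat_smul]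
  have hsum : ∀ (s : Finset ℕ) (Z : ℕ → Matrix (Fin N) (Fin N) (DPoly C V)),
      (∑ i ∈ s, Z i).map (delta C V) = ∑ i ∈ s, (Z i).map (delta C V) := fun s Z => by
    ext i j : 1
    simp only [Matrix.map_apply, Matrix.sum_apply, map_sum]
  have hpow : ∀ i : ℕ, ((f • const V M) ^ (i + 1)).map (delta C V) =
      ((i + 1 : ℕ) : ℚ) • ((delta C V f • const V M) * (f • const V M) ^ i) := fun i => by
    rw [smul_pow, ← const_pow, map_delta_smul_const, Derivation.leibniz_pow, smul_pow,
      Nat.add_sub_cancel, smul_mul_smul_comm, ← const_pow, ← const_mul, ← pow_succ', smul_eq_mul,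
      Nat.cast_smul_eq_nsmul, ← smul_assoc, mul_comm]
  rw [IsNilpotent.exp_eq_sum hk2, hsum, Finset.sum_range_succ', Finset.mul_sum]
  have h0 : ((f • const V M) ^ 0).map (delta C V) = 0 := by
    rw [pow_zero, ← const_one, map_delta_const]
  rw [hmap, h0, smul_zero, add_zero, Finset.sum_range_succ, hk1, smul_zero, mul_zero, add_zero]
  refine Finset.sum_congr rfl fun i _ => ?_
  rw [hmap, hpow, smul_smul, Nat.factorial_succ, Nat.cast_mul, mul_inv, mul_right_comm,
    inv_mul_cancel₀ (by positivity), one_mul, mul_smul_comm]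

end

end DiffAlg
end

/-! ### The height filtration and the unipotent factor -/

noncomputable section

open DiffAlg MvPolynomial ClassicalGroup

namespace ChevalleyBasis

section

variable {C : Type*} [Field C] {N : ℕ} {G : ClassicalGroup C N} {l m : ℕ} {P : RootEnum G l m}
  (B : ChevalleyBasis P) (L : List (Fin m))

/-- The polynomial ring `C[b_i | i ∈ L]`. -/
def bRing (C : Type*) [Field C] {l m : ℕ} (L : List (Fin m)) : Subalgebra C (DPoly C (GVar l m)) :=
  supported C {d | ∃ i ∈ L, d = (GVar.b i, 0)}

/-- The span over `C[b_i | i ∈ L]` of the basis elements of height below `h`. -/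
def lowSpan (h : ℤ) : Submodule (bRing C (l := l) L) (Matrix (Fin N) (Fin N) (DPoly C (GVar l m))) :=
  Submodule.span _ ((fun k => const (GVar l m) (B.vec k)) '' {k | P.weightHeight k < h})

variable {L}

theorem lowSpan_mono {h h' : ℤ} (hh : h ≤ h') : B.lowSpan L h ≤ B.lowSpan L h' :=
  Submodule.span_mono (Set.image_mono fun _ hk => lt_of_lt_of_le hk hh)

theorem smul_mem_lowSpan {h : ℤ} {f : DPoly C (GVar l m)} (hf : f ∈ bRing C L)
    {Z : Matrix (Fin N) (Fin N) (DPoly C (GVar l m))} (hZ : Z ∈ B.lowSpan L h) :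
    f • Z ∈ B.lowSpan L h :=
  Submodule.smul_mem _ (⟨f, hf⟩ : bRing C L) hZ

theorem const_mem_lowSpan {γ : G.Wt} {M : Matrix (Fin N) (Fin N) C} (hM : M ∈ G.weightSpace γ)
    {h : ℤ} (hγ : ∀ k, P.weight k = γ → P.weightHeight k < h) :
    const (GVar l m) M ∈ B.lowSpan L h := by
  refine Submodule.span_induction (fun M hM => ?_) ?_ (fun M M' _ _ hM hM' => ?_)
    (fun c M _ hM => ?_) (B.weightSpace_le_span γ hM)
  · obtain ⟨k, hk, rfl⟩ := hM
    exact Submodule.subset_span ⟨k, hγ k hk, rfl⟩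
  · rw [const_zero]; exact zero_mem _
  · rw [const_add]; exact add_mem hM hM'
  · rw [const_smul]; exact B.smul_mem_lowSpan (Subalgebra.algebraMap_mem _ c) hM

/-- Bracketing with X_{-α_i} lowers the height by ht α_i ≥ 1. If the sum of the weights is the
weight of no basis element, the height condition is vacuous. -/
theorem lie_mem_lowSpan [CharZero C] {f : DPoly C (GVar l m)} (hf : f ∈ bRing C L) (i : Fin m) {h : ℤ}
    {Z : Matrix (Fin N) (Fin N) (DPoly C (GVar l m))} (hZ : Z ∈ B.lowSpan L (h + 1)) :
    (f • const (GVar l m) (B.X (-P.root i))) * Z - Z * (f • const (GVar l m) (B.X (-P.root i))) ∈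
      B.lowSpan L h := by
  refine Submodule.span_induction (fun Z hZ => ?_) ?_ (fun Z Z' _ _ hZ hZ' => ?_)
    (fun c Z _ hZ => ?_) hZ
  · obtain ⟨k, hk, rfl⟩ := hZ
    rw [Matrix.smul_mul, Matrix.mul_smul, ← smul_sub, ← const_mul, ← const_mul, ← const_sub]
    refine B.smul_mem_lowSpan hf (B.const_mem_lowSpan (lie_mem_weightSpace
      (B.X_mem _ (P.isRoot_neg_root i)) (B.vec_mem_weightSpace k)) fun k' hk' => ?_)
    obtain ⟨ℓ, hℓ⟩ := P.exists_heightFunctional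
    have h1 := congrArg ℓ hk'
    have h2 := hℓ (Sum.inr (Sum.inr i))
    simp only [RootEnum.weight, RootEnum.weightHeight, Sum.elim_inr] at h2
    rw [map_add, h2, hℓ, hℓ, ← Int.cast_add] at h1
    have h3 := Int.cast_injective h1
    have h4 := P.height_pos i
    have h5 : P.weightHeight k < h + 1 := hk
    omega
  · rw [mul_zero, zero_mul, sub_zero]; exact zero_mem _
  · rw [mul_add, add_mul, add_sub_add_comm]; exact add_mem hZ hZ'
  · have := Submodule.smul_mem _ c hZ
    rwa [smul_sub, ← Matrix.mul_smul, ← Matrix.smul_mul] at this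

theorem isNilpotent_smul_const [CharZero C] (f : DPoly C (GVar l m)) (i : Fin m) :
    IsNilpotent (f • const (GVar l m) (B.X (-P.root i))) := by
  obtain ⟨k, hk⟩ := isNilpotent_of_mem_weightSpace (P.isRoot_neg_root i).1
    (B.X_mem _ (P.isRoot_neg_root i))
  exact ⟨k, by rw [smul_pow, ← const_pow, hk, const_zero, smul_zero]⟩

theorem rootElt_mul_exp_neg [CharZero C] (i : Fin m) : B.rootElt i * IsNilpotent.exp
    (-((MvPolynomial.X (GVar.b i, 0) : DPoly C (GVar l m)) • const (GVar l m) (B.X (-P.root i)))) = 1 :=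
  IsNilpotent.exp_mul_exp_neg_self (B.isNilpotent_smul_const _ i)

theorem inv_rootElt [CharZero C] (i : Fin m) : (B.rootElt i)⁻¹ = IsNilpotent.exp
    (-((MvPolynomial.X (GVar.b i, 0) : DPoly C (GVar l m)) • const (GVar l m) (B.X (-P.root i)))) :=
  Matrix.inv_eq_right_inv (B.rootElt_mul_exp_neg i)

theorem rootElt_mul_inv [CharZero C] (i : Fin m) : B.rootElt i * (B.rootElt i)⁻¹ = 1 := by
  rw [inv_rootElt, rootElt_mul_exp_neg]

theorem X_b_mem_bRing {i : Fin m} (hi : i ∈ L) : (MvPolynomial.X (GVar.b i, 0) : DPoly C (GVar l m)) ∈ bRing C L :=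
  X_mem_supported.2 ⟨i, hi, rfl⟩

/-- Conjugation is the exponential of the bracket with b_i X_{-α_i}. Subtracting `Z` leaves its
positive powers, each of which lowers the height. -/
theorem rootElt_conj_sub_mem [CharZero C] {i : Fin m} (hi : i ∈ L) {h : ℤ}
    {Z : Matrix (Fin N) (Fin N) (DPoly C (GVar l m))} (hZ : Z ∈ B.lowSpan L (h + 1)) :
    B.rootElt i * Z * (B.rootElt i)⁻¹ - Z ∈ B.lowSpan L h := by
  rw [inv_rootElt]
  obtain ⟨k, hk⟩ := IsNilpotent.exp_mul_mul_exp_neg (B.isNilpotent_smul_const (MvPolynomial.X (GVar.b i, 0)) i) Z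
  rw [rootElt, hk]
  set T := LinearMap.mulLeft ℚ ((MvPolynomial.X (GVar.b i, 0) : DPoly C (GVar l m)) •
    const (GVar l m) (B.X (-P.root i))) - LinearMap.mulRight ℚ ((MvPolynomial.X (GVar.b i, 0) :
    DPoly C (GVar l m)) • const (GVar l m) (B.X (-P.root i))) with hT
  have hstep : ∀ Z' ∈ B.lowSpan L (h + 1), T Z' ∈ B.lowSpan L h := fun Z' hZ' =>
    B.lie_mem_lowSpan (X_b_mem_bRing hi) i hZ'
  have hpow : ∀ j, (T ^ (j + 1)) Z ∈ B.lowSpan L h := by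
    intro j
    induction j with
    | zero => rw [zero_add, pow_one]; exact hstep _ hZ
    | succ j ih =>
      rw [pow_succ', Module.End.mul_apply]
      exact hstep _ (B.lowSpan_mono (by omega) ih)
  rw [Finset.sum_range_succ', Nat.factorial_zero, Nat.cast_one, inv_one, one_smul, pow_zero,
    Module.End.one_apply, add_sub_cancel_right]
  refine Submodule.sum_mem _ fun j _ => ?_
  exact Submodule.smul_of_tower_mem _ _ (hpow j)

/-- Conjugation by `u_w` alters an element only by terms of smaller height. -/
theorem unipotent_conj_sub_mem [CharZero C] {L' : List (Fin m)} (hL' : ∀ i ∈ L', i ∈ L) {h : ℤ}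
    {Z : Matrix (Fin N) (Fin N) (DPoly C (GVar l m))} (hZ : Z ∈ B.lowSpan L (h + 1)) :
    B.unipotent L' * Z * (B.unipotent L')⁻¹ - Z ∈ B.lowSpan L h := by
  induction L' with
  | nil => simp [unipotent]
  | cons i L' ih =>
    have h1 := ih fun j hj => hL' j (List.mem_cons_of_mem _ hj)
    have hU : B.unipotent (i :: L') = B.rootElt i * B.unipotent L' := by
      simp [unipotent]
    rw [hU, Matrix.mul_inv_rev]
    set Z' := B.unipotent L' * Z * (B.unipotent L')⁻¹ - Z with hZ'
    have h2 : B.unipotent L' * Z * (B.unipotent L')⁻¹ = Z + Z' := by rw [hZ']; abel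
    have h3 : B.rootElt i * B.unipotent L' * Z * ((B.unipotent L')⁻¹ * (B.rootElt i)⁻¹) - Z =
        (B.rootElt i * (Z + Z') * (B.rootElt i)⁻¹ - (Z + Z')) + Z' := by
      rw [← h2]; simp only [mul_assoc]; rw [hZ']; simp only [mul_assoc]; abel
    rw [h3]
    exact add_mem (B.rootElt_conj_sub_mem (hL' i List.mem_cons_self)
      (add_mem hZ (B.lowSpan_mono (by omega) h1))) h1

theorem map_delta_rootElt_mul_inv [CharZero C] (i : Fin m) :
    (B.rootElt i).map (delta C (GVar l m)) * (B.rootElt i)⁻¹ =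
      (MvPolynomial.X (GVar.b i, 1) : DPoly C (GVar l m)) • const (GVar l m) (B.X (-P.root i)) := by
  have h := map_delta_exp (MvPolynomial.X (GVar.b i, 0) : DPoly C (GVar l m)) (isNilpotent_of_mem_weightSpace
    (P.isRoot_neg_root i).1 (B.X_mem _ (P.isRoot_neg_root i)))
  have h1 : delta C (GVar l m) (MvPolynomial.X (GVar.b i, 0)) = MvPolynomial.X (GVar.b i, 1) := by
    rw [delta, mkDerivation_X]
  rw [h1] at h
  change (B.rootElt i).map _ = _ * B.rootElt i at h
  rw [h, mul_assoc, rootElt_mul_inv, mul_one]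

theorem const_neg_root_mem_lowSpan (i : Fin m) :
    const (GVar l m) (B.X (-P.root i)) ∈ B.lowSpan L (-(P.height i : ℤ) + 1) :=
  Submodule.subset_span ⟨Sum.inr (Sum.inr i), by simp [RootEnum.weightHeight], rfl⟩

theorem unipotent_mul_inv [CharZero C] (L : List (Fin m)) : B.unipotent L * (B.unipotent L)⁻¹ = 1 := by
  induction L with
  | nil => simp [unipotent]
  | cons i L' ih =>
    have hU : B.unipotent (i :: L') = B.rootElt i * B.unipotent L' := by
      simp [unipotent]
    rw [hU, Matrix.mul_inv_rev, mul_assoc, ← mul_assoc (B.unipotent L'), ih, one_mul,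
      rootElt_mul_inv]

/-- The logarithmic derivative of `u_w` is `∑ b_i' X_{-α_i}` up to terms `b_i' Z_i` with `Z_i` of height
below that of `-α_i`. -/
theorem exists_logDeriv_unipotent [CharZero C] {L' : List (Fin m)} (hnodup : L'.Nodup)
    (hL' : ∀ i ∈ L', i ∈ L) :
    ∃ Z : Fin m → Matrix (Fin N) (Fin N) (DPoly C (GVar l m)),
      (∀ i, Z i ∈ B.lowSpan L (-(P.height i : ℤ))) ∧
      (B.unipotent L').map (delta C (GVar l m)) * (B.unipotent L')⁻¹ =
        ∑ i ∈ L'.toFinset, (MvPolynomial.X (GVar.b i, 1) : DPoly C (GVar l m)) •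
          (const (GVar l m) (B.X (-P.root i)) + Z i) := by
  induction L' with
  | nil =>
    refine ⟨0, fun i => zero_mem _, ?_⟩
    have := map_delta_const (V := GVar l m) (1 : Matrix (Fin N) (Fin N) C)
    rw [const_one] at this
    simp [unipotent, this]
  | cons i L' ih =>
    obtain ⟨Z, hZ, h⟩ := ih (List.nodup_cons.1 hnodup).2 fun j hj => hL' j (List.mem_cons_of_mem _ hj)
    have hi := (List.nodup_cons.1 hnodup).1
    have hU : B.unipotent (i :: L') = B.rootElt i * B.unipotent L' := by
      simp [unipotent]
    -- By the product rule the new factor contributes exactly b_i' X_{-α_i}, hence correction 0,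
    -- while the earlier terms get conjugated by it. Absence of duplicates keeps the two cases
    -- apart.
    refine ⟨fun j => if j = i then 0 else B.rootElt i * (const (GVar l m) (B.X (-P.root j)) + Z j) *
      (B.rootElt i)⁻¹ - const (GVar l m) (B.X (-P.root j)), fun j => ?_, ?_⟩
    · dsimp only
      split_ifs
      · exact zero_mem _
      · have h1 := B.rootElt_conj_sub_mem (hL' i List.mem_cons_self)
          (add_mem (B.const_neg_root_mem_lowSpan j) (B.lowSpan_mono (by omega) (hZ j)))
        convert add_mem h1 (hZ j) using 1
        abel
    · have hU' := B.unipotent_mul_inv L'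
      rw [List.toFinset_cons, Finset.sum_insert (by simpa using hi)]
      beta_reduce
      rw [if_pos rfl, add_zero, ← map_delta_rootElt_mul_inv, hU, map_delta_mul, Matrix.mul_inv_rev, add_mul]
      congr 1
      · rw [mul_assoc, ← mul_assoc (B.unipotent L'), hU', one_mul]
      · have h2 : B.rootElt i * (B.unipotent L').map (delta C (GVar l m)) * ((B.unipotent L')⁻¹ *
            (B.rootElt i)⁻¹) = B.rootElt i * ((B.unipotent L').map (delta C (GVar l m)) *
              (B.unipotent L')⁻¹) * (B.rootElt i)⁻¹ := by simp only [mul_assoc]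
        rw [h2, h, Finset.mul_sum, Finset.sum_mul]
        refine Finset.sum_congr rfl fun j hj => ?_
        have hji : j ≠ i := by rintro rfl; exact hi (by simpa using hj)
        rw [if_neg hji, add_sub_cancel, Matrix.mul_smul, Matrix.smul_mul]

/-- Coordinates of elements of `lowSpan`. -/
theorem exists_coords_of_mem_lowSpan {h : ℤ} {Z : Matrix (Fin N) (Fin N) (DPoly C (GVar l m))}
    (hZ : Z ∈ B.lowSpan L h) : ∃ z : Fin l ⊕ (Fin m ⊕ Fin m) → DPoly C (GVar l m),
      (∀ k, z k ∈ bRing C L) ∧ (∀ k, h ≤ P.weightHeight k → z k = 0) ∧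
      Z = ∑ k, z k • const (GVar l m) (B.vec k) := by
  classical
  refine Submodule.span_induction (fun Z hZ => ?_) ?_ (fun Z Z' _ _ hZ hZ' => ?_)
    (fun c Z _ hZ => ?_) hZ
  · obtain ⟨k, hk, rfl⟩ := hZ
    refine ⟨Pi.single k 1, fun k' => ?_, fun k' hk' => ?_, ?_⟩
    · by_cases hkk : k' = k
      · subst hkk; rw [Pi.single_eq_same]; exact one_mem _
      · rw [Pi.single_eq_of_ne hkk]; exact zero_mem _
    · refine Pi.single_eq_of_ne ?_ _
      rintro rfl
      exact absurd (show P.weightHeight k' < h from hk) (not_lt.2 hk')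
    · rw [Finset.sum_eq_single k (fun k' _ hkk => by rw [Pi.single_eq_of_ne hkk, zero_smul])
        (fun hk => absurd (Finset.mem_univ k) hk), Pi.single_eq_same, one_smul]
  · exact ⟨0, fun _ => zero_mem _, fun _ _ => rfl, by simp⟩
  · obtain ⟨z, h1, h2, h3⟩ := hZ
    obtain ⟨z', h1', h2', h3'⟩ := hZ'
    refine ⟨z + z', fun k => add_mem (h1 k) (h1' k), fun k hk => ?_, ?_⟩
    · rw [Pi.add_apply, h2 k hk, h2' k hk, add_zero]
    · simp only [h3, h3', Pi.add_apply, add_smul, Finset.sum_add_distrib]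
  · obtain ⟨z, h1, h2, h3⟩ := hZ
    refine ⟨fun k => c * z k, fun k => mul_mem c.2 (h1 k), fun k hk => ?_, ?_⟩
    · simp only [h2 k hk, mul_zero]
    · simp only [h3, mul_smul, Finset.smul_sum]
      rfl

end

end ChevalleyBasis

end

/-! ### Coordinates of the gauge transform and the theorem -/

noncomputable section

open DiffAlg MvPolynomial ClassicalGroup

namespace ChevalleyBasis

section

variable {C : Type*} [Field C] {N : ℕ} {G : ClassicalGroup C N} {l m : ℕ} {P : RootEnum G l m}
  (B : ChevalleyBasis P) {L : List (Fin m)}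

theorem combo_eq_sum (x y : Fin m → DPoly C (GVar l m)) (z : Fin l → DPoly C (GVar l m)) :
    B.combo x y z = ∑ k, (Sum.elim z (Sum.elim x y)) k • const (GVar l m) (B.vec k) := by
  simp only [combo, Fintype.sum_sum_type, Sum.elim_inl, Sum.elim_inr, vec]
  abel

/-- The coordinates of the general element of the Lie algebra. -/
def genericCoord (C : Type*) [Field C] {l m : ℕ} : Fin l ⊕ (Fin m ⊕ Fin m) → DPoly C (GVar l m) :=
  Sum.elim (fun j => MvPolynomial.X (GVar.a0 j, 0)) (Sum.elim (fun i => MvPolynomial.X (GVar.ap i, 0))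
    fun i => MvPolynomial.X (GVar.am i, 0))

theorem bRing_le_subring : bRing C (l := l) L ≤ subring C (varsOf L) :=
  supported_mono fun d hd => by
    obtain ⟨i, hi, rfl⟩ := hd
    intro j hj
    obtain rfl : i = j := by simpa using hj
    exact hi

theorem genericCoord_mem_subring (k) : genericCoord C k ∈ subring C (varsOf (l := l) L) := by
  rcases k with k | k | k <;> exact X_mem_supported.2 fun i hi => by simp at hi

theorem bRing_le_lowerVars (i : Fin m) : bRing C (l := l) L ≤ supported C (lowerVars P L i) :=
  supported_mono fun d hd => by
    obtain ⟨i, hi, rfl⟩ := hd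
    refine ⟨fun j hj => ?_, by simp, by simp, by simp⟩
    obtain rfl : i = j := by simpa using hj
    exact hi

theorem genericCoord_mem_lowerVars {i : Fin m} {k} (hk : -(P.height i : ℤ) < P.weightHeight k) :
    genericCoord C k ∈ supported C (lowerVars P L i) := by
  rcases k with k | k | k <;>
    refine X_mem_supported.2 ⟨fun i hi => by simp at hi, by simp, by simp, fun j hj => ?_⟩
  · simp at hj
  · simp at hj
  · obtain rfl : k = j := by simpa using hj
    simpa [RootEnum.weightHeight] using hk

theorem X_b_mem_subring {i : Fin m} (hi : i ∈ L) (k : ℕ) :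
    (MvPolynomial.X (GVar.b i, k) : DPoly C (GVar l m)) ∈ subring C (varsOf L) :=
  X_mem_supported.2 fun j hj => by
    obtain rfl : i = j := by simpa using hj
    exact hi

theorem X_b_mem_lowerVars {i j : Fin m} (hj : j ∈ L) (hij : P.height j < P.height i) :
    (MvPolynomial.X (GVar.b j, 1) : DPoly C (GVar l m)) ∈ supported C (lowerVars P L i) :=
  X_mem_supported.2 ⟨fun i hi => by
    obtain rfl : j = i := by simpa using hi
    exact hj, le_rfl, fun _ => ⟨j, rfl, hij⟩, by simp⟩

/-- The coordinates of the gauge transform by `u_w` of the general element of the Lie algebra. -/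
theorem exists_coords_gauge_unipotent [CharZero C] (hL : L.Nodup) :
    ∃ y : Fin l ⊕ (Fin m ⊕ Fin m) → DPoly C (GVar l m),
      (∀ k, y k ∈ subring C (varsOf L)) ∧
      (∀ i ∈ L, ∃ q ∈ supported C (lowerVars P L i), y (Sum.inr (Sum.inr i)) =
        MvPolynomial.X (GVar.b i, 1) + (MvPolynomial.X (GVar.am i, 0) + q)) ∧
      B.unipotent L * B.generic * (B.unipotent L)⁻¹ +
        (B.unipotent L).map (delta C (GVar l m)) * (B.unipotent L)⁻¹ =
          ∑ k, y k • const (GVar l m) (B.vec k) := by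
  classical
  have h1 : ∀ k, B.unipotent L * const (GVar l m) (B.vec k) * (B.unipotent L)⁻¹ -
      const (GVar l m) (B.vec k) ∈ B.lowSpan L (P.weightHeight k) := fun k =>
    B.unipotent_conj_sub_mem (fun i hi => hi)
      (Submodule.subset_span ⟨k, lt_add_one (P.weightHeight k), rfl⟩)
  choose z hz1 hz2 hz3 using fun k => B.exists_coords_of_mem_lowSpan (h1 k)
  obtain ⟨Z, hZ, hU⟩ := B.exists_logDeriv_unipotent hL (fun i hi => hi)
  choose z' hz1' hz2' hz3' using fun i => B.exists_coords_of_mem_lowSpan (hZ i)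
  -- The contributions are the general element, its change under conjugation, and the logarithmic
  -- derivative.
  refine ⟨fun k => genericCoord C k + ∑ k', genericCoord C k' * z k' k + ∑ i ∈ L.toFinset,
    MvPolynomial.X (GVar.b i, 1) * ((if k = Sum.inr (Sum.inr i) then 1 else 0) + z' i k),
    fun k => ?_, fun i hi => ?_, ?_⟩
  · refine add_mem (add_mem (genericCoord_mem_subring k) (Subalgebra.sum_mem _ fun k' _ => mul_mem
      (genericCoord_mem_subring k') (bRing_le_subring (hz1 _ _)))) (Subalgebra.sum_mem _ fun i hi =>
        mul_mem (X_b_mem_subring (by simpa using hi) _) (add_mem ?_ (bRing_le_subring (hz1' _ _))))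
    split_ifs
    · exact one_mem _
    · exact zero_mem _
  · refine ⟨∑ k', genericCoord C k' * z k' (Sum.inr (Sum.inr i)) + ∑ j ∈ L.toFinset,
      MvPolynomial.X (GVar.b j, 1) * z' j (Sum.inr (Sum.inr i)), add_mem (Subalgebra.sum_mem _ fun k _ => ?_)
        (Subalgebra.sum_mem _ fun j hj => ?_), ?_⟩
    -- Corrections only go down in height, so only coordinates from strictly above -ht α_i reach
    -- X_{-α_i}. This leaves a⁺, a⁰ and the a⁻_j with ht α_j < ht α_i.
    · rcases le_or_gt (P.weightHeight k) (P.weightHeight (Sum.inr (Sum.inr i))) with h | h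
      · rw [hz2 _ _ h, mul_zero]; exact zero_mem _
      · exact mul_mem (genericCoord_mem_lowerVars h) (bRing_le_lowerVars i (hz1 _ _))
    · rcases le_or_gt (P.height i) (P.height j) with h | h
      · rw [hz2' _ _ (by simpa [RootEnum.weightHeight] using h), mul_zero]; exact zero_mem _
      · exact mul_mem (X_b_mem_lowerVars (by simpa using hj) h) (bRing_le_lowerVars i (hz1' _ _))
    · have h2 : ∑ j ∈ L.toFinset, (MvPolynomial.X (GVar.b j, 1) : DPoly C (GVar l m)) *
          (if (Sum.inr (Sum.inr i) : Fin l ⊕ (Fin m ⊕ Fin m)) = Sum.inr (Sum.inr j) then 1 else 0) =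
          MvPolynomial.X (GVar.b i, 1) := by
        rw [Finset.sum_eq_single i (fun j _ hj => by simp [Ne.symm hj])
          (fun h => absurd (List.mem_toFinset.2 hi) h)]
        simp
      simp only [mul_add, Finset.sum_add_distrib]
      rw [h2]
      simp only [genericCoord, Sum.elim_inr]
      ring
  · have h3 : ∀ k, B.unipotent L * const (GVar l m) (B.vec k) * (B.unipotent L)⁻¹ =
        const (GVar l m) (B.vec k) + ∑ k', z k k' • const (GVar l m) (B.vec k') := fun k => by
      rw [← hz3 k]; abel
    have h4 : B.generic = ∑ k, genericCoord C k • const (GVar l m) (B.vec k) := B.combo_eq_sum _ _ _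
    have h5 : ∀ i, const (GVar l m) (B.X (-P.root i)) = ∑ k : Fin l ⊕ (Fin m ⊕ Fin m),
        (if k = Sum.inr (Sum.inr i) then (1 : DPoly C (GVar l m)) else 0) •
          const (GVar l m) (B.vec k) := fun i => by
      rw [Finset.sum_eq_single (Sum.inr (Sum.inr i)) (fun k _ hk => by rw [if_neg hk, zero_smul])
        (fun h => absurd (Finset.mem_univ _) h), if_pos rfl, one_smul]
      rfl
    rw [hU, h4, Finset.mul_sum, Finset.sum_mul]
    simp only [Matrix.mul_smul, Matrix.smul_mul, h3]
    have h6 : ∀ i, const (GVar l m) (B.X (-P.root i)) + Z i = ∑ k : Fin l ⊕ (Fin m ⊕ Fin m),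
        ((if k = Sum.inr (Sum.inr i) then (1 : DPoly C (GVar l m)) else 0) + z' i k) •
          const (GVar l m) (B.vec k) := fun i => by
      rw [h5, hz3', ← Finset.sum_add_distrib]
      simp only [add_smul]
    simp only [h6, smul_add, Finset.smul_sum, smul_smul, add_smul, Finset.sum_add_distrib,
      Finset.sum_smul]
    refine congrArg₂ (· + ·) (congrArg₂ (· + ·) rfl Finset.sum_comm) ?_
    simp only [mul_add, add_smul, Finset.sum_add_distrib]
    exact congrArg₂ (· + ·) Finset.sum_comm Finset.sum_comm

theorem coords_unique {x y : Fin l ⊕ (Fin m ⊕ Fin m) → DPoly C (GVar l m)}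
    (h : ∑ k, x k • const (GVar l m) (B.vec k) = ∑ k, y k • const (GVar l m) (B.vec k)) : x = y := by
  rw [← sub_eq_zero, ← Finset.sum_sub_distrib] at h
  simp only [← sub_smul] at h
  exact sub_eq_zero.1 (linearIndependent_const B.indep (x := x - y) h)

theorem unit_mul_inv (n : GL (Fin N) C) : const (GVar l m) (n : Matrix (Fin N) (Fin N) C) *
    const (GVar l m) ((n⁻¹ : GL (Fin N) C) : Matrix (Fin N) (Fin N) C) = 1 := by
  rw [← const_mul, ← Units.val_mul, mul_inv_cancel, Units.val_one, const_one]

/-- The coordinates of the gauge transform by `n(w) u_w` of the general element. -/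
theorem exists_coords_gauge [CharZero C] (hLn : L.Nodup) {n : GL (Fin N) C}
    {w : G.Wt ≃ₗ[C] G.Wt} (hn : Represents G n w) :
    ∃ f : Fin l ⊕ (Fin m ⊕ Fin m) → DPoly C (GVar l m),
      (∀ k, f k ∈ subring C (varsOf L)) ∧
      (∀ i r, i ∈ L → w (-P.root i) = P.root r → HasShape P L i (f (Sum.inr (Sum.inl r)))) ∧
      DiffAlg.gauge (const (GVar l m) (n : Matrix (Fin N) (Fin N) C) * B.unipotent L) B.generic =
        ∑ k, f k • const (GVar l m) (B.vec k) := by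
  obtain ⟨y, hy1, hy2, hy3⟩ := B.exists_coords_gauge_unipotent hLn
  -- the matrix of the conjugation by `n`
  have hd : ∀ k, ∃ d : Fin l ⊕ (Fin m ⊕ Fin m) → C, (∀ k', P.weight k' ≠ w (P.weight k) → d k' = 0) ∧
      (n : Matrix (Fin N) (Fin N) C) * B.vec k * ((n⁻¹ : GL (Fin N) C) : Matrix (Fin N) (Fin N) C) =
        ∑ k', d k' • B.vec k' := fun k => by
    have h1 := B.weightSpace_le_span _ (conj_mem_weightSpace hn (B.vec_mem_weightSpace k))
    obtain ⟨c, hc, hc'⟩ := (Finsupp.mem_span_image_iff_linearCombination C).1 h1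
    refine ⟨c, fun k' hk' => ?_, ?_⟩
    · by_contra h
      exact hk' (hc (Finsupp.mem_support_iff.2 h))
    · rw [← hc', Finsupp.linearCombination_apply]
      exact Finsupp.sum_fintype _ _ fun _ => zero_smul _ _
  choose d hd1 hd2 using hd
  refine ⟨fun k' => ∑ k, y k * MvPolynomial.C (d k k'), fun k' => Subalgebra.sum_mem _ fun k _ =>
    mul_mem (hy1 k) (Subalgebra.algebraMap_mem _ _), fun i r hi hir => ⟨hi, ?_⟩, ?_⟩
  · obtain ⟨q, hq, hyq⟩ := hy2 i hi
    have hw : ∀ k, w (P.weight k) = P.root r → k = Sum.inr (Sum.inr i) := fun k hk =>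
      P.weight_eq_neg_root (w.injective (hk.trans hir.symm))
    -- The constant is the factor by which n(w) carries X_{-α_i} to X_{α_r}. Were it zero,
    -- conjugation by an invertible matrix would kill X_{-α_i}.
    refine ⟨d (Sum.inr (Sum.inr i)) (Sum.inr (Sum.inl r)), fun h0 => ?_, q, hq, ?_⟩
    · have h1 := hd2 (Sum.inr (Sum.inr i))
      have h2 : ∑ k', d (Sum.inr (Sum.inr i)) k' • B.vec k' = 0 := by
        refine Finset.sum_eq_zero fun k' _ => ?_
        by_cases hk' : P.weight k' = w (P.weight (Sum.inr (Sum.inr i)))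
        · have : k' = Sum.inr (Sum.inl r) := P.weight_eq_root (hk'.trans hir)
          rw [this, h0, zero_smul]
        · rw [hd1 _ _ hk', zero_smul]
      rw [h2] at h1
      refine LinearIndependent.ne_zero (Sum.inr (Sum.inr i)) B.indep ?_
      change B.vec (Sum.inr (Sum.inr i)) = 0
      calc B.vec (Sum.inr (Sum.inr i)) = ((n⁻¹ : GL (Fin N) C) : Matrix (Fin N) (Fin N) C) *
            ((n : Matrix (Fin N) (Fin N) C) * B.vec (Sum.inr (Sum.inr i)) *
              ((n⁻¹ : GL (Fin N) C) : Matrix (Fin N) (Fin N) C)) * n := by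
              rw [mul_assoc _ _ (n : Matrix (Fin N) (Fin N) C), mul_assoc _ _
                (n : Matrix (Fin N) (Fin N) C), ← Units.val_mul, inv_mul_cancel, Units.val_one, mul_one,
                ← mul_assoc, ← Units.val_mul, inv_mul_cancel, Units.val_one, one_mul]
        _ = 0 := by rw [h1, mul_zero, zero_mul]
    · beta_reduce
      rw [Finset.sum_eq_single (Sum.inr (Sum.inr i)) (fun k _ hk => ?_)
        (fun h => absurd (Finset.mem_univ _) h), hyq, mul_comm]
      rw [hd1 k (Sum.inr (Sum.inl r)) fun h => hk (hw k h.symm), C_0, mul_zero]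
  · have hinv : (const (GVar l m) (n : Matrix (Fin N) (Fin N) C))⁻¹ =
        const (GVar l m) ((n⁻¹ : GL (Fin N) C) : Matrix (Fin N) (Fin N) C) :=
      Matrix.inv_eq_right_inv (unit_mul_inv n)
    have h1 : DiffAlg.gauge (const (GVar l m) (n : Matrix (Fin N) (Fin N) C) * B.unipotent L) B.generic =
        const (GVar l m) (n : Matrix (Fin N) (Fin N) C) * (B.unipotent L * B.generic *
          (B.unipotent L)⁻¹ + (B.unipotent L).map (delta C (GVar l m)) * (B.unipotent L)⁻¹) *
            const (GVar l m) ((n⁻¹ : GL (Fin N) C) : Matrix (Fin N) (Fin N) C) := by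
      rw [DiffAlg.gauge, map_delta_mul, map_delta_const, zero_mul, zero_add, Matrix.mul_inv_rev, hinv]
      simp only [mul_add, add_mul, mul_assoc]
    rw [h1, hy3, Finset.mul_sum, Finset.sum_mul]
    simp only [Matrix.mul_smul, Matrix.smul_mul, ← const_mul, hd2, const_sum, const_smul,
      Finset.smul_sum, Finset.sum_smul, smul_smul]
    exact Finset.sum_comm

end

end ChevalleyBasis

end

theorem theorem5p5 {C : Type*} [Field C] [IsAlgClosed C] [CharZero C] {N l m : ℕ}
    (G : ClassicalGroup C N) (P : RootEnum G l m) (B : ChevalleyBasis P)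
    (w : G.Wt ≃ₗ[C] G.Wt) (hw : w ∈ B.weylGroup) (hres : P.IsResolving w)
    (n : GL (Fin N) C) (hn : Represents G n w)
    -- the indices `i₁, …, i_k` with `w(Φ⁺) ∩ Φ⁻ = {-α_{i₁}, …, -α_{i_k}}`
    (L : List (Fin m)) (hLnodup : L.Nodup)
    (hL : ∀ i, i ∈ L ↔ -P.root i ∈ (w '' P.positive) ∩ P.negative)
    (rk : DiffAlg.Ranking (GVar l m)) (hrk : IsAdapted P rk) :
    -- the coefficients of the gauge transform exist, are unique and lie in `C{a⁺, a⁻, a⁰, b_w}`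
    (∃! F : Coeffs C l m, IsGaugeCoeffs B n L F) ∧
    ∀ F : Coeffs C l m, IsGaugeCoeffs B n L F →
      ((∀ i, F.fp i ∈ DiffAlg.subring C (varsOf L)) ∧
        (∀ i, F.fm i ∈ DiffAlg.subring C (varsOf L)) ∧
        (∀ j, F.f0 j ∈ DiffAlg.subring C (varsOf L))) ∧
      -- the system `S_w` (without inequations) is simple
      DiffAlg.IsSimpleSystem rk (systemEqs F) (fun j : Empty => j.elim) ∧
      -- the leader of `f⁺_r` is the derivative of `b_i`, where `-α_i = w⁻¹(α_r) ∈ Ψ`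
      (∀ r : Fin m, l ≤ (r : ℕ) → ∃ i : Fin m, -P.root i = w.symm (P.root r) ∧
        DiffAlg.IsLeader rk (F.fp r) (GVar.b i, 1)) ∧
      -- the equations are linear in their leaders with constant initials
      (∀ r : Fin m, l ≤ (r : ℕ) → ∀ d, DiffAlg.IsLeader rk (F.fp r) d →
        (F.fp r).degreeOf d = 1 ∧
        ∃ c : C, c ≠ 0 ∧ DiffAlg.initialAt (F.fp r) d = MvPolynomial.C c) ∧
      -- the generated differential ideal is prime, in `C{a⁺, a⁻, a⁰, b_w}`
      -- and in `C{a⁺, a⁻, a⁰, b}`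
      (DiffAlg.diffIdealIn (varsOf L) (Set.range (systemEqs F))).IsPrime ∧
      (DiffAlg.diffIdeal (Set.range (systemEqs F))).IsPrime ∧
      -- if `b_i'` is the leader of `f⁺_r`, then `a⁻_i` appears linearly with constant coefficient
      -- and no other `a⁻_j` with `|height (-α_j)| ≥ |height (-α_i)|` appears
      (∀ r i : Fin m, l ≤ (r : ℕ) → DiffAlg.IsLeader rk (F.fp r) (GVar.b i, 1) →
        (∃ c : C, c ≠ 0 ∧ ∀ k : ℕ, (GVar.am i, k) ∉
          (F.fp r - MvPolynomial.C c * MvPolynomial.X (GVar.am i, 0)).vars) ∧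
        ∀ j : Fin m, j ≠ i → P.height i ≤ P.height j →
          ∀ k : ℕ, (GVar.am j, k) ∉ (F.fp r).vars) := by
  obtain ⟨f, hf1, hf2, hf3⟩ := B.exists_coords_gauge hLnodup hn
  have hiff : ∀ F : Coeffs C l m, IsGaugeCoeffs B n L F ↔
      F = ⟨fun i => f (Sum.inr (Sum.inl i)), fun i => f (Sum.inr (Sum.inr i)), fun j => f (Sum.inl j)⟩ := by
    intro F
    unfold IsGaugeCoeffs
    rw [hf3, B.combo_eq_sum]
    constructor
    · intro h
      have h1 := B.coords_unique h
      rw [h1]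
      rfl
    · rintro rfl
      refine Finset.sum_congr rfl fun k _ => ?_
      rcases k with k | k | k <;> rfl
  -- The simple roots are enumerated first, so `r` indexes a non-simple positive root. As w is
  -- resolving, w⁻¹(α_r) lies in w(Φ⁺) ∩ Φ⁻, so its b_i really occurs in u_w.
  have hidx : ∀ r : {r : Fin m // l ≤ (r : ℕ)}, ∃ i : Fin m, i ∈ L ∧ w (-P.root i) = P.root r := by
    rintro ⟨r, hr⟩
    obtain ⟨Ψ, h1, h2, h3⟩ := hres
    have hmem : P.root r ∈ P.positive \ P.simples := by
      refine ⟨⟨r, rfl⟩, ?_⟩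
      rintro ⟨j, hj⟩
      have := P.root_inj hj
      rw [← this] at hr
      simp only [Fin.val_castLE] at hr
      omega
    rw [← h2] at hmem
    obtain ⟨ψ, hψ, hwψ⟩ := hmem
    obtain ⟨i, rfl⟩ := h1 hψ
    exact ⟨i, (hL i).2 (h3 hψ), hwψ⟩
  choose idx hidxL hidxw using hidx
  have hinj : Function.Injective idx := fun r s hrs => Subtype.ext (P.root_inj (by
    rw [← hidxw, ← hidxw, hrs]))
  refine ⟨⟨_, (hiff _).2 rfl, fun F hF => (hiff F).1 hF⟩, fun F hF => ?_⟩
  obtain rfl := (hiff F).1 hF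
  set F : Coeffs C l m := ⟨fun i => f (Sum.inr (Sum.inl i)), fun i => f (Sum.inr (Sum.inr i)),
    fun j => f (Sum.inl j)⟩ with hFdef
  have hshape : ∀ r, HasShape P L (idx r) (systemEqs F r) := fun r => hf2 _ _ (hidxL r) (hidxw r)
  have hlead : ∀ (r : Fin m) (hr : l ≤ (r : ℕ)), DiffAlg.IsLeader rk (F.fp r) (GVar.b (idx ⟨r, hr⟩), 1) :=
    fun r hr => (hshape ⟨r, hr⟩).isLeader hrk
  refine ⟨⟨fun i => hf1 _, fun i => hf1 _, fun j => hf1 _⟩, isSimpleSystem_of_hasShape hrk hinj hshape,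
    fun r hr => ⟨idx ⟨r, hr⟩, ?_, hlead r hr⟩, fun r hr d hd => ?_,
    isPrime_diffIdealIn_of_hasShape hinj hshape, isPrime_diffIdeal_of_hasShape hinj hshape,
    fun r i hr hi => ?_⟩
  · rw [← hidxw ⟨r, hr⟩, LinearEquiv.symm_apply_apply]
  · obtain rfl := hd.unique (hlead r hr)
    obtain ⟨h1, c, hc, h2, -⟩ := (hshape ⟨r, hr⟩).degree_initial_separant
    exact ⟨h1, c, hc, h2⟩
  · obtain rfl : i = idx ⟨r, hr⟩ := by simpa using hi.unique (hlead r hr)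
    exact (hshape ⟨r, hr⟩).am_notMem
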